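/- Let $d\ge 2$. For $(c,a)=(c_1,\dots,c_{d-2},a)\in\mathbb{C}^{d-1}$ let $$P_{c,a}(z)=\frac1d z^d+\sum_{j=2}^{d-1}\frac{(-1)^{d-j}}{j}\,\sigma_{d-j}(c)\,z^j+a^d,$$ where $\sigma_k(c)$ is the $k$-th elementary symmetric polynomial in $c_1,\dots,c_{d-2}$. Thus $P_{c,a}$ is the polynomial of degree $d$ with leading coefficient $1/d$ whose critical points are $c_0:=0,c_1,\dots,c_{d-2}$ (with multiplicity) and such that $P_{c,a}(0)=a^d$. For $0\le i\le d-2$ let $\alpha_i(c,a)=P_{c,a}(c_i)$, which is a homogeneous polynomial of degree $d$ in $(c,a)$, and $$\mathcal{B}_i=\Big\{(c,a)\in\mathbb{C}^{d-1} : \sup_{n\ge 0}|P_{c,a}^{n}(c_i)|<\infty\Big\},$$ where $P_{c,a}^{n}$ is the $n$-th iterate. Embed $\mathbb{C}^{d-1}$ in $\mathbb{P}^{d-1}$ by $(c,a)\mapsto[c:a:1]$, let $\mathbb{P}_\infty=\{[c:a:0] : (c,a)\in\mathbb{C}^{d-1}\setminus\{0\}\}$ be the hyperplane at infinity, and let $$\Gamma_i=\{[c:a:0]\in\mathbb{P}_\infty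 : \alpha_i(c,a)=0\}.$$ Then for every $0\le i\le d-2$ the cluster set of $\mathcal{B}_i$ in $\mathbb{P}_\infty$, that is, the set of points of $\mathbb{P}_\infty$ that lie in the closure of $\mathcal{B}_i$ in $\mathbb{P}^{d-1}$, is contained in $\Gamma_i$. Moreover the connectedness locus, that is, the set of $(c,a)\in\mathbb{C}^{d-1}$ such that the Julia set of $P_{c,a}$ (the set of points of the Riemann sphere near which the family of iterates $(P_{c,a}^{n})_{n\ge0}$ is not equicontinuous) is connected, is compact in $\mathbb{C}^{d-1}$. -/

import Mathlib

open scoped LinearAlgebra.Projectivization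

/-! ### The family `P_{c,a}` -/

/-- The parameter space `ℂ^{d-1}` of pairs `(c, a)` with `c = (c_1, …, c_{d-2})`. -/
abbrev Param (d : ℕ) : Type := (Fin (d - 2) → ℂ) × ℂ

/-- The elementary symmetric function `σ_k(c)` of `c = (c_1, …, c_{d-2})`. -/
noncomputable def sigma {d : ℕ} (c : Fin (d - 2) → ℂ) (k : ℕ) : ℂ :=
  ((Finset.univ : Finset (Fin (d - 2))).val.map c).esymm k

/-- `P_{c,a} = z^d / d + ∑_{j=2}^{d-1} ((-1)^{d-j} / j) σ_{d-j}(c) z^j + a^d`. -/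
noncomputable def polyFamily (d : ℕ) (p : Param d) : Polynomial ℂ :=
  Polynomial.C (1 / (d : ℂ)) * Polynomial.X ^ d
    + ∑ j ∈ Finset.Icc 2 (d - 1),
        Polynomial.C ((-1) ^ (d - j) / (j : ℂ) * sigma p.1 (d - j)) * Polynomial.X ^ j
    + Polynomial.C (p.2 ^ d)

/-- The marked critical points `c_0 = 0, c_1, …, c_{d-2}`. -/
def critPt {d : ℕ} (p : Param d) : Fin (d - 2 + 1) → ℂ :=
  Fin.cons 0 p.1

/-- `α_i(c, a) = P_{c,a}(c_i)`. -/
noncomputable def alpha (d : ℕ) (i : Fin (d - 2 + 1)) (p : Param d) : ℂ :=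
  (polyFamily d p).eval (critPt p i)

/-- `B_i`: the parameters for which the forward orbit of `c_i` under `P_{c,a}` is bounded. -/
def boundedCritLocus (d : ℕ) (i : Fin (d - 2 + 1)) : Set (Param d) :=
  {p | BddAbove (Set.range fun n : ℕ =>
    ‖(fun z : ℂ => (polyFamily d p).eval z)^[n] (critPt p i)‖)}

/-! ### The projective compactification of the parameter space -/

/-- The quotient topology on a projective space. -/
instance projectivizationTopology {V : Type*} [AddCommGroup V] [Module ℂ V]
    [TopologicalSpace V] : TopologicalSpace (ℙ ℂ V) :=
  inferInstanceAs (TopologicalSpace (Quotient (projectivizationSetoid ℂ V)))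

/-- `ℙ^{d-1}`, with homogeneous coordinates `[c : a : t]`. -/
abbrev ProjParam (d : ℕ) : Type := ℙ ℂ (Param d × ℂ)

/-- The embedding `(c, a) ↦ [c : a : 1]` of the parameter space. -/
noncomputable def affineEmb (d : ℕ) (p : Param d) : ProjParam d :=
  Projectivization.mk ℂ (p, (1 : ℂ)) (fun h => one_ne_zero (congrArg Prod.snd h))

/-- The point `[c : a : 0]`, for `(c, a) ≠ 0`. -/
noncomputable def pointAtInfinity (d : ℕ) (p : Param d) (hp : p ≠ 0) : ProjParam d :=
  Projectivization.mk ℂ (p, (0 : ℂ)) (fun h => hp (congrArg Prod.fst h))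

/-- The projective space at infinity `{[c : a : 0]}`. -/
def hyperplaneAtInfinity (d : ℕ) : Set (ProjParam d) :=
  {x | ∃ (p : Param d) (hp : p ≠ 0), x = pointAtInfinity d p hp}

/-- `Γ_i = {[c : a : 0] | α_i(c, a) = 0}`. -/
def Gam (d : ℕ) (i : Fin (d - 2 + 1)) : Set (ProjParam d) :=
  {x | ∃ (p : Param d) (hp : p ≠ 0), x = pointAtInfinity d p hp ∧ alpha d i p = 0}

/-- The cluster set at infinity of a set `S` of parameters. -/
def clusterSetAtInfinity (d : ℕ) (S : Set (Param d)) : Set (ProjParam d) :=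
  {x | x ∈ hyperplaneAtInfinity d ∧ ClusterPt x (Filter.principal (affineEmb d '' S))}

/-! ### Julia sets and the connectedness locus -/

/-- The extension of a nonconstant polynomial to the Riemann sphere, with `∞ ↦ ∞`. -/
noncomputable def sphereMap (P : Polynomial ℂ) : OnePoint ℂ → OnePoint ℂ :=
  OnePoint.map fun z : ℂ => P.eval z

/-- The unique uniform structure of the Riemann sphere (a compact Hausdorff space) that is
compatible with its topology; it is the one of the spherical metric. -/
@[reducible]
noncomputable def sphereUniformSpace : UniformSpace (OnePoint ℂ) :=
  uniformSpaceOfCompactR1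

/-- The Julia set of a (nonconstant) polynomial: the points of the Riemann sphere near which
the family of iterates is not equicontinuous. -/
def juliaSet (P : Polynomial ℂ) : Set (OnePoint ℂ) :=
  letI : UniformSpace (OnePoint ℂ) := sphereUniformSpace
  {z | ¬ ∃ U ∈ nhds z, EquicontinuousOn (fun n : ℕ => (sphereMap P)^[n]) U}

/-- The connectedness locus: the parameters for which the Julia set of `P_{c,a}` is connected. -/
def connectednessLocus (d : ℕ) : Set (Param d) :=
  {p | IsConnected (juliaSet (polyFamily d p))}

/-! Outside a disc of radius `Λ‖p‖ + 4d`, where `p = (c, a)`, the polynomial at least doubles moduli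
(`exists_isEscapeRadius`). If the orbit of `c_i` is bounded, its first iterate `α_i` therefore has
modulus below this radius (`norm_alpha_lt`). The radius is linear in `‖p‖` while `α_i` is
homogeneous of degree `d ≥ 2`, so `α_i` vanishes at every limit at infinity of such parameters: this
is the claim on cluster sets.

For compactness, the connectedness locus is the intersection of the closed sets `B_i`
(`connectednessLocus_eq`). The `α_i` vanish together only at the origin
(`eq_zero_of_alpha_eq_zero`), so `∑ |α_i|` is at least a constant times `‖p‖^d`, and the same linear
bound makes the locus bounded.

The description of the locus rests on Fatou's criterion: the Julia set, which is the frontier of the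
filled Julia set `K` (`juliaSet_eq`), is connected iff all critical orbits are bounded. If `∂K` is
connected and `w₀ ∈ ∂K`, all roots of `Q = P^n - w₀` lie in `∂K`. Then `Q` has a holomorphic root of
order `deg Q` on `{|Q| > 2R}`, which leaves no critical point there
(`derivative_ne_zero_of_isPreconnected`), so none can escape. Conversely, if no critical point
escapes, the preimage under `P^n` of a circle outside the escape disc is the image of a vertical
line under a lift of an exponential, hence connected (`isPreconnected_level`). These preimages
accumulate exactly on `∂K` (`isPreconnected_frontier_of_levels`). -/

section

open Polynomial Set Filter Topology

/-! ### Filled Julia sets -/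

/-- `R` is an escape radius of `P`: outside the disc of radius `R`, the modulus at least doubles. -/
def IsEscapeRadius (P : ℂ[X]) (R : ℝ) : Prop :=
  0 < R ∧ ∀ z : ℂ, R ≤ ‖z‖ → 2 * ‖z‖ ≤ ‖P.eval z‖

/-- The filled Julia set: the points with bounded forward orbit. -/
def filledJulia (P : ℂ[X]) : Set ℂ :=
  {z | BddAbove (range fun n : ℕ => ‖(fun z : ℂ => P.eval z)^[n] z‖)}

/-- The iterates of `P`, as polynomials. -/
noncomputable def iterPoly (P : ℂ[X]) (n : ℕ) : ℂ[X] := P.comp^[n] X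

lemma eval_iterPoly (P : ℂ[X]) (n : ℕ) (z : ℂ) :
    (iterPoly P n).eval z = (fun z : ℂ => P.eval z)^[n] z := by
  simp [iterPoly, iterate_comp_eval]

lemma eval_iterPoly_succ (P : ℂ[X]) (n : ℕ) (z : ℂ) :
    (iterPoly P (n + 1)).eval z = P.eval ((iterPoly P n).eval z) := by
  simp only [eval_iterPoly, Function.iterate_succ_apply']

lemma eval_iterPoly_zero (P : ℂ[X]) (z : ℂ) : (iterPoly P 0).eval z = z := by
  simp [eval_iterPoly]

lemma eval_iterPoly_add (P : ℂ[X]) (m n : ℕ) (z : ℂ) :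
    (iterPoly P (m + n)).eval z = (iterPoly P m).eval ((iterPoly P n).eval z) := by
  simp only [eval_iterPoly, Function.iterate_add_apply]

lemma iterPoly_succ (P : ℂ[X]) (n : ℕ) : iterPoly P (n + 1) = P.comp (iterPoly P n) := by
  simp only [iterPoly, Function.iterate_succ_apply']

lemma mem_filledJulia {P : ℂ[X]} {z : ℂ} :
    z ∈ filledJulia P ↔ ∃ B, ∀ n, ‖(iterPoly P n).eval z‖ ≤ B := by
  simp [filledJulia, BddAbove, upperBounds, Set.Nonempty, eval_iterPoly]

lemma eval_iterPoly_mem_filledJulia_iff {P : ℂ[X]} (n : ℕ) {z : ℂ} :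
    (iterPoly P n).eval z ∈ filledJulia P ↔ z ∈ filledJulia P := by
  constructor
  · rw [mem_filledJulia, mem_filledJulia]
    rintro ⟨B, hB⟩
    have hfin : BddAbove ((fun k => ‖(iterPoly P k).eval z‖) '' Iio n) :=
      ((finite_Iio n).image _).bddAbove
    obtain ⟨B', hB'⟩ := hfin
    refine ⟨max B B', fun k => ?_⟩
    rcases lt_or_ge k n with hk | hk
    · exact (hB' ⟨k, hk, rfl⟩).trans (le_max_right _ _)
    · obtain ⟨m, rfl⟩ := Nat.exists_eq_add_of_le' hk
      rw [eval_iterPoly_add]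
      exact (hB m).trans (le_max_left _ _)
  · rw [mem_filledJulia, mem_filledJulia]
    rintro ⟨B, hB⟩
    exact ⟨B, fun k => by rw [← eval_iterPoly_add]; exact hB _⟩

lemma exists_lt_norm_iter {P : ℂ[X]} {z : ℂ} (hz : z ∉ filledJulia P) (B : ℝ) :
    ∃ n, B < ‖(iterPoly P n).eval z‖ := by
  by_contra! hB
  exact hz (mem_filledJulia.2 ⟨B, hB⟩)

namespace IsEscapeRadius

variable {P : ℂ[X]} {R : ℝ} (h : IsEscapeRadius P R)
include h

lemma two_pow_mul_norm_le {z : ℂ} (hz : R ≤ ‖z‖) (n : ℕ) :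
    2 ^ n * ‖z‖ ≤ ‖(iterPoly P n).eval z‖ := by
  induction n with
  | zero => simp [eval_iterPoly_zero]
  | succ n ih =>
    rw [eval_iterPoly_succ]
    have h1 : (1 : ℝ) ≤ 2 ^ n := one_le_pow₀ (by norm_num)
    have h2 : R ≤ ‖(iterPoly P n).eval z‖ := by nlinarith [norm_nonneg z]
    have h3 := h.2 _ h2
    rw [pow_succ]
    linarith

lemma norm_le_norm_iter {z : ℂ} (hz : R ≤ ‖z‖) (n : ℕ) : ‖z‖ ≤ ‖(iterPoly P n).eval z‖ :=
  (le_mul_of_one_le_left (norm_nonneg z) (one_le_pow₀ (by norm_num))).trans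
    (h.two_pow_mul_norm_le hz n)

lemma lt_norm_iter_of_le {r : ℝ} (hr : R ≤ r) {z : ℂ} {m n : ℕ} (hmn : m ≤ n)
    (hz : r < ‖(iterPoly P m).eval z‖) : r < ‖(iterPoly P n).eval z‖ := by
  obtain ⟨k, rfl⟩ := Nat.exists_eq_add_of_le' hmn
  rw [eval_iterPoly_add]
  exact hz.trans_le (h.norm_le_norm_iter (hr.trans hz.le) k)

lemma notMem_of_le_norm {z : ℂ} (hz : R ≤ ‖z‖) : z ∉ filledJulia P := by
  rw [mem_filledJulia]
  rintro ⟨B, hB⟩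
  have hz0 : 0 < ‖z‖ := h.1.trans_le hz
  obtain ⟨n, hn⟩ := pow_unbounded_of_one_lt (B / ‖z‖) (one_lt_two : (1 : ℝ) < 2)
  rw [div_lt_iff₀ hz0] at hn
  exact absurd ((h.two_pow_mul_norm_le hz n).trans (hB n)) (not_le.2 hn)

/-- An orbit that once reaches modulus `R` escapes. The weak form `mem_iff_le` gives closedness; the
strict one keeps the level sets of height `r ≥ R` off the filled Julia set. -/
lemma mem_iff_lt {z : ℂ} : z ∈ filledJulia P ↔ ∀ n, ‖(iterPoly P n).eval z‖ < R := by
  constructor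
  · intro hz n
    by_contra! hn
    exact h.notMem_of_le_norm hn ((eval_iterPoly_mem_filledJulia_iff n).2 hz)
  · exact fun hz => mem_filledJulia.2 ⟨R, fun n => (hz n).le⟩

lemma mem_iff_le {z : ℂ} : z ∈ filledJulia P ↔ ∀ n, ‖(iterPoly P n).eval z‖ ≤ R :=
  ⟨fun hz n => (h.mem_iff_lt.1 hz n).le, fun hz => mem_filledJulia.2 ⟨R, hz⟩⟩

lemma isClosed_filledJulia : IsClosed (filledJulia P) := by
  have : filledJulia P = ⋂ n, {z | ‖(iterPoly P n).eval z‖ ≤ R} := by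
    ext z; simp [h.mem_iff_le]
  rw [this]
  exact isClosed_iInter fun n => isClosed_le (iterPoly P n).continuous.norm continuous_const

lemma isCompact_filledJulia : IsCompact (filledJulia P) := by
  refine (isCompact_closedBall (0 : ℂ) R).of_isClosed_subset h.isClosed_filledJulia fun z hz => ?_
  simpa [eval_iterPoly_zero] using h.mem_iff_le.1 hz 0

lemma frontier_subset : frontier (filledJulia P) ⊆ filledJulia P :=
  h.isClosed_filledJulia.frontier_subset

lemma isCompact_frontier : IsCompact (frontier (filledJulia P)) :=
  h.isCompact_filledJulia.of_isClosed_subset isClosed_frontier h.frontier_subset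

lemma filledJulia_ne_univ : filledJulia P ≠ univ := by
  intro hu
  refine h.notMem_of_le_norm (z := (R : ℂ)) ?_ (hu ▸ mem_univ _)
  simpa using le_abs_self R

lemma frontier_nonempty (hne : (filledJulia P).Nonempty) : (frontier (filledJulia P)).Nonempty :=
  nonempty_frontier_iff.2 ⟨hne, h.filledJulia_ne_univ⟩

lemma tendsto_norm : Tendsto (fun z : ℂ => ‖P.eval z‖) (cocompact ℂ) atTop := by
  refine tendsto_atTop_mono' _ ?_ (tendsto_norm_cocompact_atTop (E := ℂ))
  filter_upwards [tendsto_norm_cocompact_atTop.eventually_ge_atTop R] with z hz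
  linarith [h.2 z hz, norm_nonneg z]

lemma tendsto_cocompact : Tendsto (fun z : ℂ => P.eval z) (cocompact ℂ) (cocompact ℂ) :=
  by
  have h1 := h.tendsto_norm
  rw [← Metric.cobounded_eq_cocompact] at h1 ⊢
  exact tendsto_norm_atTop_iff_cobounded.1 h1

lemma continuous_sphereMap : Continuous (sphereMap P) := by
  refine OnePoint.continuous_map P.continuous ?_
  simpa only [coclosedCompact_eq_cocompact] using h.tendsto_cocompact

/-- A point of the frontier is approximated by preimages of each large circle. -/
lemma exists_level_point {r : ℝ} (hr : R ≤ r) {z : ℂ} (hz : z ∈ frontier (filledJulia P))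
    {U : Set ℂ} (hU : U ∈ 𝓝 z) : ∀ᶠ n in atTop, ∃ y ∈ U, ‖(iterPoly P n).eval y‖ = r := by
  obtain ⟨ε, hε, hεU⟩ := Metric.mem_nhds_iff.1 hU
  rw [frontier_eq_closure_inter_closure] at hz
  obtain ⟨x, hxK, hx⟩ := Metric.mem_closure_iff.1 hz.1 ε hε
  obtain ⟨y, hyK, hy⟩ := Metric.mem_closure_iff.1 hz.2 ε hε
  obtain ⟨m, hm⟩ := exists_lt_norm_iter hyK r
  filter_upwards [eventually_ge_atTop m] with n hn
  have hyn := h.lt_norm_iter_of_le hr hn hm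
  have hxn := h.mem_iff_lt.1 hxK n
  have hpre : IsPreconnected (Metric.ball z ε) := (convex_ball z ε).isPreconnected
  obtain ⟨w, hw, hwr⟩ := hpre.intermediate_value (f := fun w => ‖(iterPoly P n).eval w‖)
    (Metric.mem_ball'.2 hx) (Metric.mem_ball'.2 hy) (iterPoly P n).continuous.norm.continuousOn
    ⟨(hxn.trans_le hr).le, hyn.le⟩
  exact ⟨w, hεU hw, hwr⟩

/-- Away from the frontier, level sets of high iterates disappear. -/
lemma eventually_no_level_point {r : ℝ} (hr : R ≤ r) {z : ℂ}
    (hz : z ∉ frontier (filledJulia P)) :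
    ∃ U ∈ 𝓝 z, ∀ᶠ n in atTop, ∀ y ∈ U, ‖(iterPoly P n).eval y‖ ≠ r := by
  by_cases hzK : z ∈ filledJulia P
  · have hint : z ∈ interior (filledJulia P) := by
      by_contra hn
      exact hz ⟨subset_closure hzK, hn⟩
    exact ⟨filledJulia P, mem_interior_iff_mem_nhds.1 hint, Eventually.of_forall fun n y hy =>
      ((h.mem_iff_lt.1 hy n).trans_le hr).ne⟩
  · obtain ⟨m, hm⟩ := exists_lt_norm_iter hzK r
    refine ⟨{y | r < ‖(iterPoly P m).eval y‖},
      (isOpen_lt continuous_const (iterPoly P m).continuous.norm).mem_nhds hm, ?_⟩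
    filter_upwards [eventually_ge_atTop m] with n hn y hy
    exact (h.lt_norm_iter_of_le hr hn hy).ne'

/-- If the preimages of a large circle under all iterates are connected, so is the frontier of
the filled Julia set. -/
lemma isPreconnected_frontier_of_levels {r : ℝ} (hr : R ≤ r)
    (hconn : ∀ n, IsPreconnected {z : ℂ | ‖(iterPoly P n).eval z‖ = r}) :
    IsPreconnected (frontier (filledJulia P)) := by
  rw [isPreconnected_closed_iff]
  intro A B hA hB hAB hfA hfB
  by_contra hemp
  have hdisj : Disjoint (frontier (filledJulia P) ∩ A) (frontier (filledJulia P) ∩ B) := by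
    rw [Set.disjoint_left]
    exact fun x hx hx' => hemp ⟨x, hx.1, hx.2, hx'.2⟩
  obtain ⟨U, V, hU, hV, hAU, hBV, hUV⟩ := SeparatedNhds.of_isCompact_isCompact
    (h.isCompact_frontier.inter_right hA) (h.isCompact_frontier.inter_right hB) hdisj
  have hC : IsCompact (Metric.closedBall (0 : ℂ) r \ (U ∪ V)) :=
    (isCompact_closedBall 0 r).diff (hU.union hV)
  -- A separation of the frontier by `U` and `V` would also separate the level sets of all high
  -- iterates: by compactness they avoid the rest of the disc.
  have hev : ∀ᶠ n in atTop, ∀ y ∈ Metric.closedBall (0 : ℂ) r \ (U ∪ V),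
      ‖(iterPoly P n).eval y‖ ≠ r := by
    refine hC.induction_on (p := fun S => ∀ᶠ n in atTop, ∀ y ∈ S, ‖(iterPoly P n).eval y‖ ≠ r)
      (by simp) (fun s t hst ht => ht.mono fun n hn y hy => hn y (hst hy))
      (fun s t hs ht => (hs.and ht).mono fun n hn y hy => hy.elim (hn.1 y) (hn.2 y)) fun z hz => ?_
    have hzf : z ∉ frontier (filledJulia P) := fun hzf =>
      hz.2 ((hAB hzf).imp (fun ha => hAU ⟨hzf, ha⟩) fun hb => hBV ⟨hzf, hb⟩)
    obtain ⟨W, hW, hWn⟩ := h.eventually_no_level_point hr hzf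
    exact ⟨W, mem_nhdsWithin_of_mem_nhds hW, hWn⟩
  obtain ⟨a, ha⟩ := hfA
  obtain ⟨b, hb⟩ := hfB
  obtain ⟨n, hn, ⟨x, hxU, hx⟩, ⟨y, hyV, hy⟩⟩ := (hev.and
    ((h.exists_level_point hr ha.1 (hU.mem_nhds (hAU ha))).and
      (h.exists_level_point hr hb.1 (hV.mem_nhds (hBV hb))))).exists
  -- The whole level set lies in the disc of radius `r`, because norms do not decrease along orbits
  -- outside it.
  obtain ⟨w, -, hwU, hwV⟩ := hconn n U V hU hV (fun z hz => by
    by_contra hzUV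
    refine hn z ⟨?_, hzUV⟩ hz
    rw [mem_closedBall_zero_iff]
    by_contra! hlt
    have := h.norm_le_norm_iter (hr.trans hlt.le) n
    rw [mem_ofPred_eq] at hz
    linarith) ⟨x, hx, hxU⟩ ⟨y, hy, hyV⟩
  exact Set.disjoint_left.1 hUV hwU hwV

end IsEscapeRadius

/-! ### The Julia set is the frontier of the filled Julia set -/

/-- Definitional: the uniformity given by `uniformSpaceOfCompactR1` is the neighbourhood filter of
the diagonal. -/
lemma mem_juliaSet {P : ℂ[X]} {z : OnePoint ℂ} :
    z ∈ juliaSet P ↔ ¬ ∃ U ∈ 𝓝 z, ∀ x ∈ U, ∀ V ∈ 𝓝ˢ (diagonal (OnePoint ℂ)),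
      ∀ᶠ y in 𝓝[U] x, ∀ n : ℕ, ((sphereMap P)^[n] x, (sphereMap P)^[n] y) ∈ V :=
  Iff.rfl

lemma iterate_sphereMap_coe (P : ℂ[X]) (n : ℕ) (z : ℂ) :
    (sphereMap P)^[n] (z : OnePoint ℂ) = ((iterPoly P n).eval z : ℂ) := by
  induction n with
  | zero => simp [eval_iterPoly_zero]
  | succ n ih => rw [Function.iterate_succ_apply', ih, eval_iterPoly_succ]; rfl

lemma iterate_sphereMap_infty (P : ℂ[X]) (n : ℕ) :
    (sphereMap P)^[n] OnePoint.infty = OnePoint.infty := by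
  induction n with
  | zero => rfl
  | succ n ih => rw [Function.iterate_succ_apply', ih]; rfl

/-- The neighbourhood `{|z| > M} ∪ {∞}` of infinity. -/
def nhdsInfty (M : ℝ) : Set (OnePoint ℂ) := ((↑) '' Metric.closedBall (0 : ℂ) M)ᶜ

lemma coe_mem_nhdsInfty {M : ℝ} {z : ℂ} : (z : OnePoint ℂ) ∈ nhdsInfty M ↔ M < ‖z‖ := by
  simp [nhdsInfty]

lemma infty_mem_nhdsInfty (M : ℝ) : OnePoint.infty ∈ nhdsInfty M := by
  simp [nhdsInfty]

lemma isOpen_nhdsInfty (M : ℝ) : IsOpen (nhdsInfty M) :=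
  OnePoint.isOpen_compl_image_coe.2 ⟨Metric.isClosed_closedBall, isCompact_closedBall _ _⟩

lemma exists_nhdsInfty_subset {W : Set (OnePoint ℂ)} (hW : W ∈ 𝓝 OnePoint.infty) (R : ℝ) :
    ∃ M, R ≤ M ∧ nhdsInfty M ⊆ W := by
  obtain ⟨K, ⟨-, hK⟩, hKW⟩ := OnePoint.hasBasis_nhds_infty.mem_iff.1 hW
  obtain ⟨M, hM⟩ := hK.isBounded.subset_closedBall (0 : ℂ)
  refine ⟨max R M, le_max_left _ _, fun x hx => ?_⟩
  induction x using OnePoint.rec with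
  | infty => exact hKW (Or.inr rfl)
  | coe x =>
    refine hKW (Or.inl ⟨x, fun hxK => ?_, rfl⟩)
    have := mem_closedBall_zero_iff.1 (hM hxK)
    exact (lt_irrefl _ (((le_max_right R M).trans_lt (coe_mem_nhdsInfty.1 hx)).trans_le this))

namespace IsEscapeRadius

variable {P : ℂ[X]} {R : ℝ} (h : IsEscapeRadius P R)
include h

lemma iterate_mem_nhdsInfty {M : ℝ} (hM : R ≤ M) {x : OnePoint ℂ} {m n : ℕ} (hmn : m ≤ n)
    (hx : (sphereMap P)^[m] x ∈ nhdsInfty M) : (sphereMap P)^[n] x ∈ nhdsInfty M := by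
  induction x using OnePoint.rec with
  | infty => rw [iterate_sphereMap_infty]; exact infty_mem_nhdsInfty M
  | coe x =>
    rw [iterate_sphereMap_coe, coe_mem_nhdsInfty] at *
    exact h.lt_norm_iter_of_le hM hmn hx

/-- From some time `m` on, the orbits of `x` and of all nearby points stay in a small neighbourhood
of infinity; continuity handles the finitely many earlier iterates. -/
lemma eventually_of_escaping {x : OnePoint ℂ} (hx : x ∉ ((↑) '' filledJulia P : Set (OnePoint ℂ)))
    {V : Set (OnePoint ℂ × OnePoint ℂ)} (hV : V ∈ 𝓝ˢ (diagonal (OnePoint ℂ))) :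
    ∀ᶠ y in 𝓝 x, ∀ n : ℕ, ((sphereMap P)^[n] x, (sphereMap P)^[n] y) ∈ V := by
  have hVx : ∀ w, V ∈ 𝓝 (w, w) := fun w => nhds_le_nhdsSet (mem_diagonal w) hV
  obtain ⟨W, hW, hWV⟩ : ∃ W ∈ 𝓝 (OnePoint.infty : OnePoint ℂ), W ×ˢ W ⊆ V := by
    have := hVx OnePoint.infty
    rw [nhds_prod_eq, mem_prod_self_iff] at this
    exact this
  obtain ⟨M, hM, hMW⟩ := exists_nhdsInfty_subset hW R
  obtain ⟨m, hm⟩ : ∃ m, (sphereMap P)^[m] x ∈ nhdsInfty M := by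
    induction x using OnePoint.rec with
    | infty => exact ⟨0, infty_mem_nhdsInfty M⟩
    | coe x =>
      obtain ⟨m, hm⟩ := exists_lt_norm_iter (fun hxK => hx ⟨x, hxK, rfl⟩) M
      exact ⟨m, by rwa [iterate_sphereMap_coe, coe_mem_nhdsInfty]⟩
  have hc : ∀ n, Continuous (sphereMap P)^[n] := fun n => h.continuous_sphereMap.iterate n
  have h1 : ∀ᶠ y in 𝓝 x, (sphereMap P)^[m] y ∈ nhdsInfty M :=
    (hc m).continuousAt.eventually_mem ((isOpen_nhdsInfty M).mem_nhds hm)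
  have h2 : ∀ᶠ y in 𝓝 x, ∀ n ∈ Iio m, ((sphereMap P)^[n] x, (sphereMap P)^[n] y) ∈ V := by
    refine (eventually_all_finite (finite_Iio m)).2 fun n _ => ?_
    have : ContinuousAt (fun y => ((sphereMap P)^[n] x, (sphereMap P)^[n] y)) x :=
      (continuous_const.prodMk (hc n)).continuousAt
    exact this.eventually_mem (hVx _)
  filter_upwards [h1, h2] with y hy1 hy2 n
  rcases lt_or_ge n m with hn | hn
  · exact hy2 n hn
  · exact hWV ⟨hMW (h.iterate_mem_nhdsInfty hM hn hm), hMW (h.iterate_mem_nhdsInfty hM hn hy1)⟩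

/-- On a disc inside `K` all iterates are bounded by `R`, so Cauchy's estimate gives them a common
Lipschitz constant near `x`. -/
lemma eventually_of_mem_interior {x : ℂ} (hx : x ∈ interior (filledJulia P))
    {V : Set (OnePoint ℂ × OnePoint ℂ)} (hV : V ∈ 𝓝ˢ (diagonal (OnePoint ℂ))) :
    ∀ᶠ y in 𝓝 (x : OnePoint ℂ), ∀ n : ℕ,
      ((sphereMap P)^[n] (x : OnePoint ℂ), (sphereMap P)^[n] y) ∈ V := by
  obtain ⟨δ, hδ, hδV⟩ : ∃ δ > 0, ∀ z w : ℂ, ‖z‖ ≤ R → ‖w - z‖ < δ →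
      ((z : OnePoint ℂ), (w : OnePoint ℂ)) ∈ V := by
    obtain ⟨O, hO, hdO, hOV⟩ := mem_nhdsSet_iff_exists.1 hV
    have hK : IsCompact ((fun z : ℂ => (z, z)) '' Metric.closedBall (0 : ℂ) R) :=
      (isCompact_closedBall 0 R).image (by fun_prop)
    have hcoe : Continuous fun q : ℂ × ℂ => ((q.1 : OnePoint ℂ), (q.2 : OnePoint ℂ)) :=
      OnePoint.continuous_coe.prodMap OnePoint.continuous_coe
    obtain ⟨δ, hδ, hsub⟩ := hK.exists_thickening_subset_open (hO.preimage hcoe) (by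
      rintro _ ⟨z, -, rfl⟩
      exact hdO (mem_diagonal _))
    refine ⟨δ, hδ, fun z w hz hw => hOV (@hsub (z, w) (Metric.mem_thickening_iff.2
      ⟨(z, z), ⟨z, mem_closedBall_zero_iff.2 hz, rfl⟩, ?_⟩))⟩
    simp [dist_eq_norm, hw]
  obtain ⟨ρ, hρ, hball⟩ := Metric.isOpen_iff.1 isOpen_interior x hx
  have hbd : ∀ y ∈ Metric.ball x ρ, ∀ n, ‖(iterPoly P n).eval y‖ ≤ R := fun y hy n =>
    h.mem_iff_le.1 (interior_subset (hball hy)) n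
  have hder : ∀ n, ∀ y ∈ Metric.ball x (ρ / 2),
      ‖deriv (fun z => (iterPoly P n).eval z) y‖ ≤ R / (ρ / 4) := by
    intro n y hy
    refine Complex.norm_deriv_le_of_forall_mem_sphere_norm_le (by positivity)
      (iterPoly P n).differentiable.diffContOnCl fun z hz => hbd z ?_ n
    rw [Metric.mem_ball] at hy ⊢
    rw [Metric.mem_sphere] at hz
    linarith [dist_triangle z y x]
  rw [OnePoint.nhds_coe_eq, eventually_map]
  have hε : 0 < min (ρ / 2) (δ / (R / (ρ / 4))) := by
    have := h.1
    positivity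
  filter_upwards [Metric.ball_mem_nhds x hε] with y hy n
  rw [iterate_sphereMap_coe, iterate_sphereMap_coe]
  refine hδV _ _ (hbd x (Metric.mem_ball_self hρ) n) ?_
  have hy1 : y ∈ Metric.ball x (ρ / 2) := Metric.ball_subset_ball (min_le_left _ _) hy
  have hy2 : ‖y - x‖ < δ / (R / (ρ / 4)) := by
    rw [← dist_eq_norm]
    exact (Metric.mem_ball.1 hy).trans_le (min_le_right _ _)
  have hpos : 0 < R / (ρ / 4) := by
    have := h.1
    positivity
  refine ((convex_ball x (ρ / 2)).norm_image_sub_le_of_norm_deriv_le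
    (f := fun z => (iterPoly P n).eval z)
    (fun z _ => (iterPoly P n).differentiable.differentiableAt) (hder n)
    (Metric.mem_ball_self (by positivity)) hy1).trans_lt ?_
  rwa [lt_div_iff₀' hpos] at hy2

theorem juliaSet_eq : juliaSet P = (↑) '' frontier (filledJulia P) := by
  ext z
  constructor
  · intro hz
    by_contra hzf
    refine mem_juliaSet.1 hz ?_
    have hcl : IsClosed ((↑) '' frontier (filledJulia P) : Set (OnePoint ℂ)) :=
      (h.isCompact_frontier.image OnePoint.continuous_coe).isClosed
    refine ⟨_, hcl.isOpen_compl.mem_nhds hzf, fun x hx V hV => nhdsWithin_le_nhds ?_⟩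
    by_cases hxK : x ∈ ((↑) '' filledJulia P : Set (OnePoint ℂ))
    · obtain ⟨w, hw, rfl⟩ := hxK
      refine h.eventually_of_mem_interior ?_ hV
      by_contra hwi
      exact hx ⟨w, ⟨subset_closure hw, hwi⟩, rfl⟩
    · exact h.eventually_of_escaping hxK hV
  · rintro ⟨z, hz, rfl⟩
    rw [mem_juliaSet]
    rintro ⟨U, hU, hUV⟩
    have hzK := h.frontier_subset hz
    have hA : IsClosed ((↑) '' Metric.closedBall (0 : ℂ) R : Set (OnePoint ℂ)) :=
      ((isCompact_closedBall (0 : ℂ) R).image OnePoint.continuous_coe).isClosed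
    have hB : IsClosed (((↑) '' Metric.ball (0 : ℂ) (R + 1))ᶜ : Set (OnePoint ℂ)) :=
      (OnePoint.isOpen_image_coe.2 Metric.isOpen_ball).isClosed_compl
    -- This entourage forbids one point in the disc of radius `R` paired with one outside the disc
    -- of radius `R + 1`. A frontier point never leaves the former, while arbitrarily close points
    -- leave the latter.
    have hV : (((↑) '' Metric.closedBall (0 : ℂ) R : Set (OnePoint ℂ)) ×ˢ
        ((↑) '' Metric.ball (0 : ℂ) (R + 1))ᶜ)ᶜ ∈ 𝓝ˢ (diagonal (OnePoint ℂ)) := by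
      refine (hA.prod hB).isOpen_compl.mem_nhdsSet.2 ?_
      rintro ⟨a, b⟩ hab ⟨ha, hb⟩
      obtain rfl : a = b := hab
      refine hb (image_mono (Metric.closedBall_subset_ball (lt_add_one R)) ha)
    have hev := hUV z (mem_of_mem_nhds hU) _ hV
    rw [nhdsWithin_eq_nhds.2 hU, OnePoint.nhds_coe_eq, eventually_map] at hev
    rw [frontier_eq_closure_inter_closure] at hz
    obtain ⟨y, hy, hyK⟩ := mem_closure_iff_nhds.1 hz.2 _ hev
    obtain ⟨n, hn⟩ := exists_lt_norm_iter hyK (R + 1)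
    refine hy n ⟨?_, ?_⟩
    · rw [iterate_sphereMap_coe]
      exact ⟨_, mem_closedBall_zero_iff.2 (h.mem_iff_le.1 hzK n), rfl⟩
    · simp only [iterate_sphereMap_coe]
      rintro ⟨w, hw, hw'⟩
      rw [OnePoint.coe_eq_coe.1 hw', mem_ball_zero_iff] at hw
      exact lt_irrefl _ (hn.trans hw)

theorem isConnected_juliaSet_iff :
    IsConnected (juliaSet P) ↔ IsConnected (frontier (filledJulia P)) := by
  rw [h.juliaSet_eq, IsConnected, IsConnected, image_nonempty,
    OnePoint.isOpenEmbedding_coe.isInducing.isPreconnected_image]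

end IsEscapeRadius

/-! ### A connected Julia set forces the critical orbits to be bounded -/

/-- The exterior of a disc is connected. -/
lemma isPreconnected_lt_norm {s : ℝ} (hs : 0 < s) : IsPreconnected {w : ℂ | s < ‖w‖} := by
  have : {w : ℂ | s < ‖w‖} = Complex.exp '' {u : ℂ | Real.log s < u.re} := by
    ext w
    simp only [mem_ofPred_eq, mem_image]
    constructor
    · intro hw
      have hw0 : w ≠ 0 := norm_pos_iff.1 (hs.trans hw)
      exact ⟨Complex.log w, by rw [Complex.log_re]; exact Real.log_lt_log hs hw,
        Complex.exp_log hw0⟩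
    · rintro ⟨u, hu, rfl⟩
      rwa [Complex.norm_exp, ← Real.log_lt_iff_lt_exp hs]
  rw [this]
  exact ((convex_halfSpace_re_gt _).isPreconnected).image _ Complex.continuous_exp.continuousOn

/-- If `w₀` and `w` lie in a connected set that stays at a positive distance from an open set `F`,
then `(z - w) / (z - w₀)` has a holomorphic logarithm on `F`. -/
lemma exists_log_ratio {E F : Set ℂ} (hE : IsPreconnected E) {δ : ℝ} (hδ : 0 < δ)
    (hEF : ∀ e ∈ E, ∀ z ∈ F, δ ≤ ‖z - e‖) {w₀ w : ℂ} (hw₀ : w₀ ∈ E) (hw : w ∈ E) :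
    ∃ f : ℂ → ℂ, (∀ z ∈ F, AnalyticAt ℂ f z) ∧ ∀ z ∈ F, z - w = (z - w₀) * Complex.exp (f z) := by
  refine hE.induction₂ (fun w₀ w => ∃ f : ℂ → ℂ, (∀ z ∈ F, AnalyticAt ℂ f z) ∧
    ∀ z ∈ F, z - w = (z - w₀) * Complex.exp (f z)) ?_ ?_ ?_ hw₀ hw
  · intro x hx
    filter_upwards [mem_nhdsWithin_of_mem_nhds (Metric.ball_mem_nhds x hδ)] with y hy
    have hne : ∀ z ∈ F, z - x ≠ 0 := fun z hz => norm_pos_iff.1 (hδ.trans_le (hEF x hx z hz))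
    -- For `y` within `δ` of `x` the ratio is at distance less than 1 from 1, where the principal
    -- logarithm is analytic.
    have hslit : ∀ z ∈ F, (z - y) / (z - x) ∈ Complex.slitPlane := by
      intro z hz
      have : (z - y) / (z - x) = 1 + (x - y) / (z - x) := by
        field_simp [hne z hz]; ring
      rw [this]
      refine Complex.mem_slitPlane_of_norm_lt_one ?_
      rw [norm_div, div_lt_one (norm_pos_iff.2 (hne z hz)), ← dist_eq_norm, dist_comm]
      exact (Metric.mem_ball.1 hy).trans_le (hEF x hx z hz)
    refine ⟨fun z => Complex.log ((z - y) / (z - x)), fun z hz => ?_, fun z hz => ?_⟩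
    · exact AnalyticAt.clog (by have := hne z hz; fun_prop (disch := assumption)) (hslit z hz)
    · rw [Complex.exp_log (Complex.slitPlane_ne_zero (hslit z hz)), mul_div_cancel₀ _ (hne z hz)]
  · rintro x y z - - - ⟨f, hf, hf'⟩ ⟨g, hg, hg'⟩
    refine ⟨fun z => f z + g z, fun z hz => (hf z hz).add (hg z hz), fun z hz => ?_⟩
    rw [Complex.exp_add, hg' z hz, hf' z hz, mul_assoc]
  · rintro x y - - ⟨f, hf, hf'⟩
    refine ⟨fun z => -f z, fun z hz => (hf z hz).neg, fun z hz => ?_⟩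
    rw [hf' z hz, mul_assoc, ← Complex.exp_add, add_neg_cancel, Complex.exp_zero, mul_one]

/-- If all roots of `Q` lie in a connected set that stays at a positive distance from `F`, then
`Q` has a holomorphic root of order `deg Q` on `F`. -/
lemma exists_analytic_root {Q : ℂ[X]} (hQ : 0 < Q.natDegree) {E F : Set ℂ}
    (hE : IsPreconnected E) {δ : ℝ} (hδ : 0 < δ) (hEF : ∀ e ∈ E, ∀ z ∈ F, δ ≤ ‖z - e‖)
    (hroots : ∀ z ∈ Q.roots, z ∈ E) :
    ∃ ψ : ℂ → ℂ, (∀ z ∈ F, AnalyticAt ℂ ψ z) ∧ ∀ z ∈ F, ψ z ^ Q.natDegree = Q.eval z := by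
  have hsplit : Q.Splits := IsAlgClosed.splits Q
  have hcard : Multiset.card Q.roots = Q.natDegree := hsplit.natDegree_eq_card_roots.symm
  obtain ⟨w₀, hw₀⟩ : ∃ w, w ∈ Q.roots := Multiset.card_pos_iff_exists_mem.1 (hcard ▸ hQ)
  -- All roots are moved to the single root `w₀` at the cost of an exponential factor, which has
  -- roots of every order.
  have key : ∀ s : Multiset ℂ, (∀ z ∈ s, z ∈ E) → ∃ f : ℂ → ℂ, (∀ z ∈ F, AnalyticAt ℂ f z) ∧
      ∀ z ∈ F, (s.map fun w => z - w).prod = (z - w₀) ^ Multiset.card s * Complex.exp (f z) := by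
    intro s
    induction s using Multiset.induction with
    | empty => exact fun _ => ⟨fun _ => 0, fun _ _ => analyticAt_const, by simp⟩
    | cons a s ih =>
      intro hs
      obtain ⟨f, hf, hf'⟩ := ih fun z hz => hs z (Multiset.mem_cons_of_mem hz)
      obtain ⟨g, hg, hg'⟩ := exists_log_ratio hE hδ hEF (hroots _ hw₀)
        (hs a (Multiset.mem_cons_self a s))
      refine ⟨fun z => f z + g z, fun z hz => (hf z hz).add (hg z hz), fun z hz => ?_⟩
      rw [Multiset.map_cons, Multiset.prod_cons, hf' z hz, hg' z hz, Complex.exp_add,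
        Multiset.card_cons, pow_succ]
      ring
  obtain ⟨f, hf, hf'⟩ := key Q.roots hroots
  have hN : (Q.natDegree : ℂ) ≠ 0 := by exact_mod_cast hQ.ne'
  obtain ⟨b, hb⟩ := IsAlgClosed.exists_pow_nat_eq Q.leadingCoeff hQ
  refine ⟨fun z => b * (z - w₀) * Complex.exp (f z / Q.natDegree), fun z hz => ?_, fun z hz => ?_⟩
  · have := hf z hz
    fun_prop (disch := assumption)
  · rw [mul_pow, mul_pow, hb, ← Complex.exp_nat_mul, mul_div_cancel₀ _ hN, mul_assoc,
      ← hcard, ← hf' z hz]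
    exact (hsplit.eval_eq_prod_roots z).symm

/-- A holomorphic root of order `deg Q` of `Q` on `{|Q| > r}` is onto the exterior of a disc. -/
lemma surj_of_analytic_root {Q : ℂ[X]} (hQ : 0 < Q.natDegree) {s : ℝ} (hs : 0 < s)
    {ψ : ℂ → ℂ} (hψ : ∀ z, s ^ Q.natDegree < ‖Q.eval z‖ → AnalyticAt ℂ ψ z)
    (hψQ : ∀ z, s ^ Q.natDegree < ‖Q.eval z‖ → ψ z ^ Q.natDegree = Q.eval z) :
    {w : ℂ | s < ‖w‖} ⊆ ψ '' {z | s ^ Q.natDegree < ‖Q.eval z‖} := by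
  set F := {z | s ^ Q.natDegree < ‖Q.eval z‖} with hF
  have hFo : IsOpen F := isOpen_lt continuous_const Q.continuous.norm
  have hdeg : 0 < Q.degree := natDegree_pos_iff_degree_pos.1 hQ
  have htend : Tendsto (fun z => ‖Q.eval z‖) (cocompact ℂ) atTop :=
    Q.tendsto_norm_atTop hdeg (tendsto_norm_cocompact_atTop (E := ℂ))
  have hmem : ∀ z ∈ F, s < ‖ψ z‖ := by
    intro z hz
    have h1 := hψQ z hz
    have h2 : s ^ Q.natDegree < ‖ψ z‖ ^ Q.natDegree := by rw [← norm_pow, h1]; exact hz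
    exact lt_of_pow_lt_pow_left₀ _ (norm_nonneg _) h2
  have hopen : IsOpen (ψ '' F) := by
    rw [isOpen_iff_mem_nhds]
    rintro _ ⟨z, hz, rfl⟩
    -- Open mapping: if `ψ` were locally constant, so would be its power `Q`.
    rcases (hψ z hz).eventually_constant_or_nhds_le_map_nhds with hc | hc
    · exfalso
      have hev : ∀ᶠ y in 𝓝 z, (Q - C (Q.eval z)).eval y = 0 := by
        filter_upwards [hc, hFo.mem_nhds hz] with y hy hyF
        rw [eval_sub, eval_C, ← hψQ y hyF, ← hψQ z hz, hy, sub_self]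
      have hinf : {y | (Q - C (Q.eval z)).eval y = 0}.Infinite := infinite_of_mem_nhds z hev
      have h0 := Polynomial.eq_zero_of_infinite_isRoot _ hinf
      rw [sub_eq_zero] at h0
      rw [h0, natDegree_C] at hQ
      exact lt_irrefl _ hQ
    · exact hc (image_mem_map (hFo.mem_nhds hz))
  -- The image is open, and closed in the connected exterior because `Q` is proper: preimages of a
  -- convergent sequence stay in a compact set.
  refine (isPreconnected_lt_norm hs).subset_of_closure_inter_subset hopen ?_ ?_
  · obtain ⟨z, hz⟩ := (htend.eventually_gt_atTop (s ^ Q.natDegree)).exists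
    exact ⟨ψ z, hmem z hz, z, hz, rfl⟩
  · rintro w ⟨hw, hsw⟩
    obtain ⟨u, hu, hulim⟩ := mem_closure_iff_seq_limit.1 hw
    choose x hxF hx using hu
    have hQlim : Tendsto (fun n => Q.eval (x n)) atTop (𝓝 (w ^ Q.natDegree)) := by
      have : (fun n => Q.eval (x n)) = fun n => u n ^ Q.natDegree :=
        funext fun n => by rw [← hψQ _ (hxF n), hx n]
      rw [this]
      exact hulim.pow _
    obtain ⟨B, hB⟩ := hQlim.norm.bddAbove_range
    have hcpt : ∃ K : Set ℂ, IsCompact K ∧ ∀ n, x n ∈ K := by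
      obtain ⟨K, hK, hKs⟩ := mem_cocompact.1 (htend.eventually_gt_atTop B)
      refine ⟨K, hK, fun n => by_contra fun hn => ?_⟩
      exact absurd (hB ⟨n, rfl⟩) (not_le.2 (hKs hn))
    obtain ⟨K, hK, hxK⟩ := hcpt
    obtain ⟨z, -, φ, hφ, hφlim⟩ := hK.tendsto_subseq hxK
    have hQz : Q.eval z = w ^ Q.natDegree :=
      tendsto_nhds_unique ((Q.continuous.tendsto z).comp hφlim) (hQlim.comp hφ.tendsto_atTop)
    have hzF : z ∈ F := by
      rw [hF, mem_ofPred_eq, hQz, norm_pow]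
      exact pow_lt_pow_left₀ hsw hs.le hQ.ne'
    refine ⟨z, hzF, tendsto_nhds_unique (((hψ z hzF).continuousAt.tendsto).comp hφlim) ?_⟩
    have : (ψ ∘ x ∘ φ) = u ∘ φ := funext fun n => hx _
    rw [this]
    exact hulim.comp hφ.tendsto_atTop

/-- If all roots of `Q` lie in a connected set that stays at a positive distance from
`{|Q| > r}`, then `Q` has no critical point in `{|Q| > r}`. -/
lemma derivative_ne_zero_of_isPreconnected {Q : ℂ[X]} (hQ : 0 < Q.natDegree) {r : ℝ} (hr : 0 < r)
    {E : Set ℂ} (hE : IsPreconnected E) {δ : ℝ} (hδ : 0 < δ)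
    (hEF : ∀ e ∈ E, ∀ z, r < ‖Q.eval z‖ → δ ≤ ‖z - e‖)
    (hroots : ∀ z ∈ Q.roots, z ∈ E) {z : ℂ} (hz : r < ‖Q.eval z‖) :
    Q.derivative.eval z ≠ 0 := by
  set N := Q.natDegree with hN
  obtain ⟨s, hs, hsr⟩ : ∃ s : ℝ, 0 < s ∧ s ^ N = r :=
    ⟨r ^ (N : ℝ)⁻¹, Real.rpow_pos_of_pos hr _, Real.rpow_inv_natCast_pow hr.le hQ.ne'⟩
  obtain ⟨ψ, hψ, hψQ⟩ := exists_analytic_root hQ hE hδ (F := {z | r < ‖Q.eval z‖}) hEF hroots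
  have hsurj := surj_of_analytic_root hQ hs (ψ := ψ) (by rwa [← hN, hsr]) (by rwa [← hN, hsr])
  rw [← hN, hsr] at hsurj
  have hz0 : Q.eval z ≠ 0 := norm_pos_iff.1 (hr.trans hz)
  have hψz : ψ z ^ N = Q.eval z := hψQ z hz
  have hprim := Complex.isPrimitiveRoot_exp N hQ.ne'
  have hcard : (nthRootsFinset N (1 : ℂ)).card = N := hprim.card_nthRootsFinset
  have hψz0 : ψ z ≠ 0 := fun h0 => hz0 (by rw [← hψz, h0, zero_pow hQ.ne'])
  have hnorm : s < ‖ψ z‖ := by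
    refine lt_of_pow_lt_pow_left₀ N (norm_nonneg _) ?_
    rwa [← norm_pow, hψz, hsr]
  -- The `N` values `ψ z * ζ` have distinct preimages, all roots of `Q - Q(z)`. This polynomial has
  -- degree `N`, so its roots are simple and `z` is not critical.
  have hpre : ∀ ζ ∈ nthRootsFinset N (1 : ℂ), ∃ y, r < ‖Q.eval y‖ ∧ ψ y = ψ z * ζ := by
    intro ζ hζ
    rw [mem_nthRootsFinset hQ] at hζ
    obtain ⟨y, hy, hy'⟩ := @hsurj (ψ z * ζ) (by
      rw [mem_ofPred_eq, norm_mul, Complex.norm_eq_one_of_pow_eq_one hζ hQ.ne', mul_one]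
      exact hnorm)
    exact ⟨y, hy, hy'⟩
  choose! y hy hyψ using hpre
  set T := Q - C (Q.eval z) with hT
  have hTdeg : T.natDegree = N := natDegree_sub_C
  have hT0 : T ≠ 0 := fun h0 => by rw [h0, natDegree_zero] at hTdeg; omega
  have hsub : (nthRootsFinset N (1 : ℂ)).image y ⊆ T.roots.toFinset := by
    intro x hx
    obtain ⟨ζ, hζ, rfl⟩ := Finset.mem_image.1 hx
    rw [Multiset.mem_toFinset, mem_roots hT0, IsRoot, hT, eval_sub, eval_C, ← hψQ _ (hy ζ hζ),
      hyψ ζ hζ, mul_pow, (mem_nthRootsFinset hQ _).1 hζ, mul_one, hψz, sub_self]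
  have hinj : Set.InjOn y (nthRootsFinset N (1 : ℂ)) := by
    intro a ha b hb hab
    have := hyψ a ha
    rw [hab, hyψ b hb] at this
    exact (mul_left_cancel₀ hψz0 this).symm
  have hge : N ≤ T.roots.toFinset.card := by
    rw [← hcard, ← Finset.card_image_of_injOn hinj]
    exact Finset.card_le_card hsub
  have hnodup : T.roots.Nodup := by
    rw [← Multiset.toFinset_card_eq_card_iff_nodup]
    refine le_antisymm (Multiset.toFinset_card_le _) ?_
    exact (card_roots' T).trans (hTdeg ▸ hge)
  intro hder
  have hmult : 1 < T.rootMultiplicity z := by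
    rw [one_lt_rootMultiplicity_iff_isRoot hT0]
    simp [hT, IsRoot, hder]
  have := Multiset.nodup_iff_count_le_one.1 hnodup z
  rw [count_roots] at this
  omega

lemma derivative_iterPoly_succ_eval (P : ℂ[X]) (n : ℕ) (z : ℂ) :
    (iterPoly P (n + 1)).derivative.eval z =
      P.derivative.eval ((iterPoly P n).eval z) * (iterPoly P n).derivative.eval z := by
  rw [iterPoly_succ, derivative_comp, eval_mul, eval_comp, mul_comm]

lemma derivative_iterPoly_eval_eq_zero {P : ℂ[X]} {c : ℂ} (hc : P.derivative.eval c = 0) {n : ℕ}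
    (hn : n ≠ 0) : (iterPoly P n).derivative.eval c = 0 := by
  induction n with
  | zero => exact absurd rfl hn
  | succ n ih =>
    rw [derivative_iterPoly_succ_eval]
    rcases eq_or_ne n 0 with rfl | hn
    · rw [eval_iterPoly_zero, hc, zero_mul]
    · rw [ih hn, mul_zero]

namespace IsEscapeRadius

variable {P : ℂ[X]} {R : ℝ} (h : IsEscapeRadius P R)
include h

lemma natDegree_iterPoly_pos (n : ℕ) : 0 < (iterPoly P n).natDegree := by
  by_contra! hn
  obtain ⟨a, ha⟩ : ∃ a, iterPoly P n = C a := ⟨_, eq_C_of_natDegree_le_zero hn⟩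
  have h1 := h.norm_le_norm_iter (z := ((R + ‖a‖ + 1 : ℝ) : ℂ)) (by
    rw [Complex.norm_real]
    exact le_trans (by linarith [norm_nonneg a]) (le_abs_self _)) n
  rw [ha, eval_C, Complex.norm_real] at h1
  linarith [Real.le_norm_self (R + ‖a‖ + 1), h.1]

/-- A nonconstant polynomial is an open map, so it sends interior points of `K` to interior points.
-/
lemma mem_frontier_of_iter_mem_frontier {n : ℕ} {z : ℂ}
    (hz : (iterPoly P n).eval z ∈ frontier (filledJulia P)) : z ∈ frontier (filledJulia P) := by
  have hzK : z ∈ filledJulia P :=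
    (eval_iterPoly_mem_filledJulia_iff n).1 (h.frontier_subset hz)
  refine ⟨subset_closure hzK, fun hint => ?_⟩
  refine hz.2 ?_
  have hopen : IsOpenMap fun z => (iterPoly P n).eval z := by
    rcases (AnalyticOnNhd.eval_polynomial (iterPoly P n)).is_constant_or_isOpenMap with
      ⟨w, hw⟩ | ho
    · exfalso
      have hd := h.natDegree_iterPoly_pos n
      have : iterPoly P n = C w := Polynomial.funext fun x => by rw [eval_C]; exact hw x
      rw [this, natDegree_C] at hd
      exact lt_irrefl _ hd
    · exact ho
  refine interior_maximal ?_ (hopen _ isOpen_interior) ⟨z, hint, rfl⟩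
  rintro _ ⟨y, hy, rfl⟩
  exact (eval_iterPoly_mem_filledJulia_iff n).2 (interior_subset hy)

theorem critPt_mem_of_isConnected (hJ : IsConnected (frontier (filledJulia P))) {c : ℂ}
    (hc : P.derivative.eval c = 0) : c ∈ filledJulia P := by
  by_contra hcK
  obtain ⟨w₀, hw₀⟩ := hJ.nonempty
  have hR := h.1
  have hw₀R : ‖w₀‖ < R := by
    simpa [eval_iterPoly_zero] using h.mem_iff_lt.1 (h.frontier_subset hw₀) 0
  -- Subtracting `w₀`, of modulus below `R`, gives `|Q(c)| > 2R`, whereas `|Q| < 2R` on the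
  -- frontier. Passing to `m + 1` ensures at least one iteration, so that `c` is critical for `Q`.
  obtain ⟨m, hm⟩ := exists_lt_norm_iter hcK (3 * R)
  have hm1 : 3 * R < ‖(iterPoly P (m + 1)).eval c‖ :=
    h.lt_norm_iter_of_le (by linarith) (Nat.le_succ m) hm
  set Q := iterPoly P (m + 1) - C w₀ with hQ
  have hQe : ∀ z, Q.eval z = (iterPoly P (m + 1)).eval z - w₀ := fun z => by simp [hQ]
  have hQdeg : 0 < Q.natDegree := by
    rw [hQ, natDegree_sub_C]
    exact h.natDegree_iterPoly_pos _
  obtain ⟨δ, hδ, hthick⟩ := h.isCompact_frontier.exists_thickening_subset_open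
    (t := {z | ‖Q.eval z‖ < 2 * R}) (isOpen_lt Q.continuous.norm continuous_const) (by
      intro z hz
      have := h.mem_iff_lt.1 (h.frontier_subset hz) (m + 1)
      rw [mem_ofPred_eq, hQe]
      linarith [norm_sub_le ((iterPoly P (m + 1)).eval z) w₀])
  refine derivative_ne_zero_of_isPreconnected hQdeg (r := 2 * R) (by linarith)
    hJ.isPreconnected hδ ?_ ?_ (z := c) ?_ ?_
  · intro e he z hz
    by_contra! hlt
    rw [← dist_eq_norm] at hlt
    have : ‖Q.eval z‖ < 2 * R := hthick (Metric.mem_thickening_iff.2 ⟨e, he, hlt⟩)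
    linarith
  · intro z hz
    have hz0 : Q.eval z = 0 := isRoot_of_mem_roots hz
    rw [hQe, sub_eq_zero] at hz0
    exact h.mem_frontier_of_iter_mem_frontier (n := m + 1) (hz0 ▸ hw₀)
  · rw [hQe]
    linarith [norm_sub_norm_le ((iterPoly P (m + 1)).eval c) w₀]
  · rw [hQ, derivative_sub, derivative_C, sub_zero]
    exact derivative_iterPoly_eval_eq_zero hc (Nat.succ_ne_zero m)

end IsEscapeRadius

/-! ### Bounded critical orbits force a connected Julia set -/

/-- Outside its critical values, `u ↦ exp (N u)` lifts uniquely through the covering `Q`. -/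
lemma existsUnique_exp_lift {Q : ℂ[X]} {N : ℕ} {s : ℝ} (hs : 0 < s)
    (hcrit : ∀ z, Q.derivative.eval z = 0 → ‖Q.eval z‖ < s ^ N)
    (a : {u : ℂ | Real.log s < u.re}) {e : ℂ} (he : Q.eval e = Complex.exp (N * a)) :
    ∃! F : C({u : ℂ | Real.log s < u.re}, ℂ), F a = e ∧
      (fun z => Q.eval z) ∘ F = fun u : {u : ℂ | Real.log s < u.re} => Complex.exp (N * u) := by
  have hconv : Convex ℝ {u : ℂ | Real.log s < u.re} := convex_halfSpace_re_gt _
  have hop : IsOpen {u : ℂ | Real.log s < u.re} :=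
    isOpen_lt continuous_const Complex.continuous_re
  have := hconv.contractibleSpace ⟨a, a.2⟩
  have := hop.locallyPathConnectedSpace
  refine Q.isCoveringMapOn_eval.existsUnique_continuousMap_lifts
    (⟨fun u => Complex.exp (N * u), by fun_prop⟩ : C({u : ℂ | Real.log s < u.re}, ℂ)) he ?_
  -- `exp (N u)` has modulus at least `s ^ N` on the half-plane, hence is not a critical value.
  rintro ⟨u, hu⟩ ⟨z, hz, hzu⟩
  have h1 := hcrit z hz
  have hzu' : Q.eval z = Complex.exp (N * u) := hzu
  have hu' : Real.log s < u.re := hu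
  rw [hzu', Complex.exp_nat_mul, norm_pow, Complex.norm_exp] at h1
  exact absurd h1 (not_lt.2 (pow_le_pow_left₀ hs.le
    ((Real.log_lt_iff_lt_exp hs).1 hu').le _))

/-- A lift of `exp (N u)` through `Q`, where `N = deg Q`, has no vertical period `τ` with
`exp τ ≠ 1`. -/
lemma exp_eq_one_of_periodic_lift {Q : ℂ[X]} (hQ : 0 < Q.natDegree) {g : ℂ → ℂ} {σ : ℝ}
    (hg : ContinuousOn g {u | σ < u.re})
    (hQg : ∀ u : ℂ, σ < u.re → Q.eval (g u) = Complex.exp (Q.natDegree * u)) {τ : ℂ}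
    (hτ : τ.re = 0) (hper : ∀ u : ℂ, σ < u.re → g (u + τ) = g u) : Complex.exp τ = 1 := by
  obtain ⟨B, hB⟩ : ∃ B, ∀ z ∈ Q.roots, z ∈ Metric.closedBall (0 : ℂ) B := by
    obtain ⟨B, hB⟩ := (Q.roots.toFinset.finite_toSet.isBounded).subset_closedBall (0 : ℂ)
    exact ⟨B, fun z hz => hB (by simpa using hz)⟩
  obtain ⟨ψ, hψ, hψQ⟩ := exists_analytic_root hQ (E := Metric.closedBall (0 : ℂ) B)
    (F := {z | B + 1 < ‖z‖}) (convex_closedBall _ _).isPreconnected one_pos (by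
      intro e he z hz
      rw [mem_closedBall_zero_iff] at he
      rw [mem_ofPred_eq] at hz
      linarith [norm_sub_norm_le z e]) hB
  obtain ⟨M, hM⟩ := ((isCompact_closedBall (0 : ℂ) (B + 1)).image
    Q.continuous.norm).bddAbove
  have hexp : Tendsto (fun t : ℝ => Real.exp (Q.natDegree * t)) atTop atTop :=
    Real.tendsto_exp_atTop.comp (tendsto_id.const_mul_atTop (by exact_mod_cast hQ))
  obtain ⟨t₀, ht₀⟩ := (hexp.eventually_gt_atTop M).exists_forall_of_atTop
  set S : Set ℂ := {u | max σ t₀ < u.re} with hS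
  have hSσ : ∀ u ∈ S, σ < u.re := fun u hu => (le_max_left _ _).trans_lt hu
  have hbig : ∀ u ∈ S, B + 1 < ‖g u‖ := by
    intro u hu
    by_contra! hle
    have h1 := hM ⟨g u, mem_closedBall_zero_iff.2 hle, rfl⟩
    have h2 := ht₀ u.re ((le_max_right _ _).trans hu.le)
    simp only [hQg u (hSσ u hu), Complex.norm_exp] at h1
    simp at h1
    linarith
  have hcont : ContinuousOn (fun u => ψ (g u) / Complex.exp u) S := by
    refine ContinuousOn.div (fun u hu => ?_) Complex.continuous_exp.continuousOn
      fun u _ => Complex.exp_ne_zero u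
    exact (hψ _ (hbig u hu)).continuousAt.comp_continuousWithinAt
      ((hg u (hSσ u hu)).mono hSσ)
  -- Far to the right this quotient is a continuous function with values in a finite set, hence
  -- constant; comparing `u` with `u + τ` gives `exp τ = 1`.
  have hmaps : MapsTo (fun u => ψ (g u) / Complex.exp u) S
      (nthRootsFinset Q.natDegree (1 : ℂ)) := by
    intro u hu
    rw [Finset.mem_coe, mem_nthRootsFinset hQ, div_pow, hψQ _ (hbig u hu), hQg u (hSσ u hu),
      ← Complex.exp_nat_mul, div_self (Complex.exp_ne_zero _)]
  set u : ℂ := ((max σ t₀ + 1 : ℝ) : ℂ) with hu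
  have huS : u ∈ S := by
    rw [hS, mem_ofPred_eq, hu, Complex.ofReal_re]
    exact lt_add_one _
  have huS' : u + τ ∈ S := by
    rw [hS, mem_ofPred_eq, Complex.add_re, hτ, add_zero]
    exact huS
  have h1 := (convex_halfSpace_re_gt (max σ t₀)).isPreconnected.constant_of_mapsTo
    (Finset.finite_toSet _).isDiscrete hcont hmaps huS huS'
  simp only [hper u (hSσ u huS)] at h1
  have hψ0 : ψ (g u) ≠ 0 := by
    intro h0
    have := hψQ _ (hbig u huS)
    rw [h0, zero_pow hQ.ne', hQg u (hSσ u huS)] at this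
    exact Complex.exp_ne_zero _ this.symm
  rw [Complex.exp_add, div_eq_div_iff (Complex.exp_ne_zero _)
    (mul_ne_zero (Complex.exp_ne_zero _) (Complex.exp_ne_zero _))] at h1
  have h2 := mul_left_cancel₀ hψ0 h1
  exact mul_left_cancel₀ (Complex.exp_ne_zero u) (by rw [h2, mul_one])

/-- If all critical values of `Q` lie in the disc of radius `R`, then the preimages of larger
circles are connected. -/
theorem isPreconnected_level {Q : ℂ[X]} (hQ : 0 < Q.natDegree) {R r : ℝ} (hR : 0 < R)
    (hcrit : ∀ z, Q.derivative.eval z = 0 → ‖Q.eval z‖ < R) (hr : R < r) :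
    IsPreconnected {z : ℂ | ‖Q.eval z‖ = r} := by
  set N := Q.natDegree with hN
  have hN0 : (N : ℂ) ≠ 0 := by exact_mod_cast hQ.ne'
  have hN0' : (0 : ℝ) < N := by exact_mod_cast hQ
  obtain ⟨s, hs, hsR⟩ : ∃ s : ℝ, 0 < s ∧ s ^ N = R :=
    ⟨R ^ (N : ℝ)⁻¹, Real.rpow_pos_of_pos hR _, Real.rpow_inv_natCast_pow hR.le hQ.ne'⟩
  rw [← hsR] at hcrit
  have hlog : Real.log s < Real.log r / N := by
    rw [lt_div_iff₀ hN0', mul_comm, ← Real.log_pow, hsR]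
    exact Real.log_lt_log hR hr
  set H : Set ℂ := {u | Real.log s < u.re} with hH
  have ha : ((Real.log r / N : ℝ) : ℂ) ∈ H := by
    rw [hH, mem_ofPred_eq, Complex.ofReal_re]
    exact hlog
  obtain ⟨e, he⟩ : ∃ e, Q.eval e = Complex.exp (N * ((Real.log r / N : ℝ) : ℂ)) := by
    obtain ⟨e, he⟩ := IsAlgClosed.exists_root (Q - C (Complex.exp (N * ((Real.log r / N : ℝ) : ℂ))))
      (fun h0 => by
        have := natDegree_eq_zero_iff_degree_le_zero.2 h0.le
        rw [natDegree_sub_C] at this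
        omega)
    exact ⟨e, by simpa [sub_eq_zero] using he⟩
  obtain ⟨G, ⟨-, hG⟩, -⟩ := existsUnique_exp_lift hs hcrit ⟨_, ha⟩ he
  have hG' : ∀ u : H, Q.eval (G u) = Complex.exp (N * u) := fun u => congrFun hG u
  classical
  set g : ℂ → ℂ := fun u => if hu : u ∈ H then G ⟨u, hu⟩ else 0 with hg
  have hgG : ∀ u (hu : u ∈ H), g u = G ⟨u, hu⟩ := fun u hu => by simp only [hg, dif_pos hu]
  have hgc : ContinuousOn g H := by
    rw [continuousOn_iff_continuous_domRestrict]
    convert G.continuous using 1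
    ext u
    exact hgG u u.2
  have hQg : ∀ u ∈ H, Q.eval (g u) = Complex.exp (N * u) := fun u hu => by
    rw [hgG u hu, hG']
  -- two lifts that agree at a point agree everywhere
  have hshift : ∀ τ : ℂ, τ.re = 0 → Complex.exp (N * τ) = 1 → ∀ u ∈ H, g (u + τ) = g u →
      Complex.exp τ = 1 := by
    intro τ hτ hexp u hu hgu
    have hmem : ∀ v ∈ H, v + τ ∈ H := fun v hv => by
      rw [hH, mem_ofPred_eq, Complex.add_re, hτ, add_zero]; exact hv
    let G' : C(H, ℂ) := ⟨fun v => G ⟨v + τ, hmem v v.2⟩, by fun_prop⟩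
    have huniq := existsUnique_exp_lift hs hcrit ⟨u, hu⟩ (hG' ⟨u, hu⟩)
    have heq : G' = G := huniq.unique ⟨by
        change G ⟨u + τ, _⟩ = _
        rw [← hgG, ← hgG, hgu], funext fun v => by
        change Q.eval (G ⟨v + τ, _⟩) = _
        rw [hG', mul_add, Complex.exp_add, hexp, mul_one]⟩ ⟨rfl, hG⟩
    refine exp_eq_one_of_periodic_lift hQ hgc hQg hτ fun v hv => ?_
    rw [hgG _ (hmem v hv), hgG v hv]
    exact DFunLike.congr_fun heq ⟨v, hv⟩
  -- Translation by `τ k` preserves `exp (N u)`, so it permutes lifts. The translates for `k < N`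
  -- are distinct at every point and thus exhaust the fibre of the degree `N` map `Q`.
  set τ : ℕ → ℂ := fun k => 2 * Real.pi * Complex.I * (k / N) with hτ
  have hτre : ∀ k, (τ k).re = 0 := by
    intro k
    have : τ k = ((2 * Real.pi * (k / N) : ℝ) : ℂ) * Complex.I := by
      simp only [hτ]; push_cast; ring
    rw [this, Complex.re_ofReal_mul, Complex.I_re, mul_zero]
  have hprim := Complex.isPrimitiveRoot_exp N hQ.ne'
  have hτexp : ∀ k, Complex.exp (τ k) = Complex.exp (2 * Real.pi * Complex.I / N) ^ k := by
    intro k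
    rw [← Complex.exp_nat_mul]
    congr 1
    simp only [hτ]
    ring
  have hτN : ∀ k, Complex.exp (N * τ k) = 1 := by
    intro k
    rw [Complex.exp_nat_mul, hτexp, pow_right_comm, hprim.pow_eq_one, one_pow]
  have hτH : ∀ k, ∀ u ∈ H, u + τ k ∈ H := fun k u hu => by
    rw [hH, mem_ofPred_eq, Complex.add_re, hτre, add_zero]; exact hu
  have hinj : ∀ u ∈ H, Set.InjOn (fun k => g (u + τ k)) (Finset.range N) := by
    intro u hu
    have key : ∀ j k, j < k → k < N → g (u + τ j) ≠ g (u + τ k) := by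
      intro j k hjk hk heq
      have hadd : u + τ k = u + τ j + τ (k - j) := by
        simp only [hτ]
        rw [Nat.cast_sub hjk.le]
        ring
      have h1 := hshift (τ (k - j)) (hτre _) (hτN _) (u + τ j) (hτH j u hu)
        (by rw [← hadd, heq])
      rw [hτexp] at h1
      exact hprim.pow_ne_one_of_pos_of_lt (by omega) (by omega) h1
    intro j hj k hk heq
    rw [Finset.mem_coe, Finset.mem_range] at hj hk
    rcases lt_trichotomy j k with hlt | rfl | hlt
    · exact absurd heq (key j k hlt hk)
    · rfl
    · exact absurd heq.symm (key k j hlt hj)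
  have hfib : ∀ u ∈ H, ∀ z, Q.eval z = Complex.exp (N * u) → ∃ k, g (u + τ k) = z := by
    intro u hu z hz
    set T := Q - C (Complex.exp (N * u)) with hT
    have hTdeg : T.natDegree = N := natDegree_sub_C
    have hT0 : T ≠ 0 := fun h0 => by rw [h0, natDegree_zero] at hTdeg; omega
    have hmemT : ∀ y, y ∈ T.roots.toFinset ↔ Q.eval y = Complex.exp (N * u) := fun y => by
      rw [Multiset.mem_toFinset, mem_roots hT0, IsRoot, hT, eval_sub, eval_C, sub_eq_zero]
    have hsub : (Finset.range N).image (fun k => g (u + τ k)) ⊆ T.roots.toFinset := by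
      intro y hy
      obtain ⟨k, -, rfl⟩ := Finset.mem_image.1 hy
      rw [hmemT, hQg _ (hτH k u hu), mul_add, Complex.exp_add, hτN, mul_one]
    have hle : T.roots.toFinset.card ≤ ((Finset.range N).image fun k => g (u + τ k)).card := by
      rw [Finset.card_image_of_injOn (hinj u hu), Finset.card_range]
      exact (Multiset.toFinset_card_le _).trans ((card_roots' T).trans hTdeg.le)
    have hz' := (hmemT z).2 hz
    rw [← Finset.eq_of_subset_of_card_le hsub hle] at hz'
    obtain ⟨k, -, hk⟩ := Finset.mem_image.1 hz'
    exact ⟨k, hk⟩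
  have hr0 : 0 < r := hR.trans hr
  have himage : {z : ℂ | ‖Q.eval z‖ = r} = g '' {u | u.re = Real.log r / N} := by
    ext z
    constructor
    · intro hz
      have hz : ‖Q.eval z‖ = r := hz
      have hz0 : Q.eval z ≠ 0 := norm_pos_iff.1 (hz ▸ hr0)
      have hre : (Complex.log (Q.eval z) / N).re = Real.log r / N := by
        rw [Complex.div_natCast_re, Complex.log_re, hz]
      have huH : Complex.log (Q.eval z) / N ∈ H := by
        rw [hH, mem_ofPred_eq, hre]; exact hlog
      obtain ⟨k, hk⟩ := hfib _ huH z (by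
        rw [mul_div_cancel₀ _ hN0, Complex.exp_log hz0])
      exact ⟨_, by rw [mem_ofPred_eq, Complex.add_re, hτre, hre, add_zero], hk⟩
    · rintro ⟨u, hu, rfl⟩
      have hu : u.re = Real.log r / N := hu
      have huH : u ∈ H := by rw [hH, mem_ofPred_eq, hu]; exact hlog
      rw [mem_ofPred_eq, hQg u huH, Complex.norm_exp, ← Complex.ofReal_natCast, Complex.re_ofReal_mul, hu,
        mul_div_cancel₀ _ hN0'.ne', Real.exp_log hr0]
  rw [himage]
  refine IsPreconnected.image ?_ _ (hgc.mono fun u hu => ?_)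
  · exact (convex_hyperplane (f := fun u : ℂ => u.re) ⟨fun _ _ => rfl, fun _ _ => by simp⟩
      _).isPreconnected
  · have hu : u.re = Real.log r / N := hu
    rw [hH, mem_ofPred_eq, hu]
    exact hlog

/-- By the chain rule, critical points of an iterate are preimages of critical points of `P`. -/
lemma mem_filledJulia_of_derivative_iterPoly_eq_zero {P : ℂ[X]}
    (hcrit : ∀ c, P.derivative.eval c = 0 → c ∈ filledJulia P) (n : ℕ) {z : ℂ}
    (hz : (iterPoly P n).derivative.eval z = 0) : z ∈ filledJulia P := by
  induction n with
  | zero => simp [iterPoly] at hz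
  | succ n ih =>
    rw [derivative_iterPoly_succ_eval, mul_eq_zero] at hz
    exact hz.elim (fun hz => (eval_iterPoly_mem_filledJulia_iff n).1 (hcrit _ hz)) ih

namespace IsEscapeRadius

variable {P : ℂ[X]} {R : ℝ} (h : IsEscapeRadius P R)
include h

theorem isPreconnected_frontier
    (hcrit : ∀ c, P.derivative.eval c = 0 → c ∈ filledJulia P) :
    IsPreconnected (frontier (filledJulia P)) :=
  h.isPreconnected_frontier_of_levels (lt_add_one R).le fun n =>
    isPreconnected_level (h.natDegree_iterPoly_pos n) h.1
      (fun _ hz => h.mem_iff_lt.1 (mem_filledJulia_of_derivative_iterPoly_eq_zero hcrit n hz) n)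
      (lt_add_one R)

/-- The Julia set is connected if and only if all critical points have bounded orbits. -/
theorem isConnected_juliaSet_iff_critPt (hne : ∃ c, P.derivative.eval c = 0) :
    IsConnected (juliaSet P) ↔ ∀ c, P.derivative.eval c = 0 → c ∈ filledJulia P := by
  rw [h.isConnected_juliaSet_iff]
  refine ⟨fun hJ c hc => h.critPt_mem_of_isConnected hJ hc, fun hcrit => ⟨?_, ?_⟩⟩
  · exact h.frontier_nonempty (hne.imp fun c hc => hcrit c hc)
  · exact h.isPreconnected_frontier hcrit

end IsEscapeRadius

/-! ### Polynomials vanishing at all their critical points -/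

/-- If every critical point of `P` is a root of `P`, there is at most one critical point. -/
lemma card_roots_derivative_le_one {P : ℂ[X]} (hP : 0 < P.natDegree)
    (hroot : ∀ t, P.derivative.IsRoot t → P.IsRoot t) :
    P.derivative.roots.toFinset.card ≤ 1 := by
  have hP0 : P ≠ 0 := fun h0 => by simp [h0] at hP
  have hdeg : P.derivative.natDegree = P.natDegree - 1 := natDegree_derivative P
  have hcard : Multiset.card P.derivative.roots = P.derivative.natDegree :=
    (IsAlgClosed.splits P.derivative).natDegree_eq_card_roots.symm
  have hmult : ∀ t ∈ P.derivative.roots.toFinset,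
      P.roots.count t = P.derivative.roots.count t + 1 := by
    intro t ht
    have ht' : P.IsRoot t := hroot t (isRoot_of_mem_roots (Multiset.mem_toFinset.1 ht))
    have hpos := (rootMultiplicity_pos hP0).2 ht'
    rw [count_roots, count_roots, derivative_rootMultiplicity_of_root ht']
    omega
  have hsub : P.derivative.roots.toFinset ⊆ P.roots.toFinset := fun t ht => by
    rw [Multiset.mem_toFinset, mem_roots hP0]
    exact hroot t (isRoot_of_mem_roots (Multiset.mem_toFinset.1 ht))
  -- With `k` distinct critical points this reads `(deg P - 1) + k ≤ deg P`.
  have hsum := Finset.sum_le_sum_of_subset (f := fun t => P.roots.count t) hsub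
  rw [Multiset.toFinset_sum_count_eq, Finset.sum_congr rfl hmult, Finset.sum_add_distrib,
    Multiset.toFinset_sum_count_eq, hcard, hdeg, Finset.sum_const, smul_eq_mul, mul_one] at hsum
  have := hsum.trans (card_roots' P)
  omega

/-! ### The family `P_{c,a}` -/

variable {d : ℕ}

lemma sigma_eq_sum (c : Fin (d - 2) → ℂ) (k : ℕ) :
    sigma c k = ∑ t ∈ Finset.univ.powersetCard k, ∏ i ∈ t, c i :=
  Finset.esymm_map_val c Finset.univ k

lemma sigma_smul (t : ℂ) (c : Fin (d - 2) → ℂ) (k : ℕ) : sigma (t • c) k = t ^ k * sigma c k := by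
  rw [sigma_eq_sum, sigma_eq_sum, Finset.mul_sum]
  refine Finset.sum_congr rfl fun s hs => ?_
  simp only [Pi.smul_apply, smul_eq_mul, Finset.prod_mul_distrib, Finset.prod_const]
  rw [(Finset.mem_powersetCard.1 hs).2]

lemma continuous_sigma_apply (k : ℕ) : Continuous fun c : Fin (d - 2) → ℂ => sigma c k := by
  simp only [sigma_eq_sum]
  fun_prop

lemma eval_polyFamily (p : Param d) (z : ℂ) :
    (polyFamily d p).eval z = 1 / (d : ℂ) * z ^ d +
      ∑ j ∈ Finset.Icc 2 (d - 1), (-1) ^ (d - j) / (j : ℂ) * sigma p.1 (d - j) * z ^ j +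
      p.2 ^ d := by
  simp [polyFamily, eval_finsetSum]

lemma eval_polyFamily_smul (t : ℂ) (p : Param d) (z : ℂ) :
    (polyFamily d (t • p)).eval (t * z) = t ^ d * (polyFamily d p).eval z := by
  rw [eval_polyFamily, eval_polyFamily, mul_add, mul_add, Finset.mul_sum]
  congr 1
  · congr 1
    · ring
    · refine Finset.sum_congr rfl fun j hj => ?_
      have hj' := Finset.mem_Icc.1 hj
      have htd : t ^ d = t ^ (d - j) * t ^ j := by rw [← pow_add]; congr 1; omega
      rw [Prod.smul_fst, sigma_smul, htd]
      ring
  · rw [Prod.smul_snd, smul_eq_mul, mul_pow]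

lemma continuous_eval_polyFamily :
    Continuous fun q : Param d × ℂ => (polyFamily d q.1).eval q.2 := by
  simp only [eval_polyFamily]
  have hs : ∀ k, Continuous fun q : Param d × ℂ => sigma q.1.1 k := fun k =>
    (continuous_sigma_apply k).comp (by fun_prop)
  fun_prop

lemma critPt_smul (t : ℂ) (p : Param d) (i : Fin (d - 2 + 1)) :
    critPt (t • p) i = t * critPt p i := by
  refine Fin.cases ?_ (fun j => ?_) i <;> simp [critPt]

lemma continuous_critPt (i : Fin (d - 2 + 1)) : Continuous fun p : Param d => critPt p i := by
  refine Fin.cases ?_ (fun j => ?_) i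
  · simpa [critPt] using continuous_const
  · simp only [critPt, Fin.cons_succ]
    fun_prop

lemma alpha_smul (i : Fin (d - 2 + 1)) (t : ℂ) (p : Param d) :
    alpha d i (t • p) = t ^ d * alpha d i p := by
  rw [alpha, alpha, critPt_smul, eval_polyFamily_smul]

lemma continuous_alpha (i : Fin (d - 2 + 1)) : Continuous (alpha d i) :=
  continuous_eval_polyFamily.comp (continuous_id.prodMk (continuous_critPt i))

lemma derivative_polyFamily (hd : 2 ≤ d) (p : Param d) :
    (polyFamily d p).derivative = X * ∏ i, (X - C (p.1 i)) := by
  have hd0 : (d : ℂ) ≠ 0 := by exact_mod_cast (by omega : d ≠ 0)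
  have hvieta : ∏ i, (X - C (p.1 i)) =
      ∑ k ∈ Finset.range (d - 2 + 1), (-1) ^ k * (C (sigma p.1 k) * X ^ (d - 2 - k)) := by
    have := Multiset.prod_X_sub_X_eq_sum_esymm ((Finset.univ : Finset (Fin (d - 2))).val.map p.1)
    rw [Multiset.map_map, Multiset.card_map, Finset.card_val, Finset.card_univ,
      Fintype.card_fin] at this
    exact this
  -- Reindexing by `k = d - j`; the Vieta term `k = 0` is left for the leading monomial.
  have hsum : ∑ j ∈ Finset.Icc 2 (d - 1),
      C ((-1) ^ (d - j) * sigma p.1 (d - j)) * X ^ (j - 1) =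
      ∑ k ∈ Finset.Icc 1 (d - 2), C ((-1) ^ k * sigma p.1 k) * X ^ (d - k - 1) := by
    refine Finset.sum_bij' (fun j _ => d - j) (fun k _ => d - k) ?_ ?_ ?_ ?_ ?_ <;>
      simp only [Finset.mem_Icc] <;> intro j hj
    · omega
    · omega
    · omega
    · omega
    · rw [Nat.sub_sub_self (by omega)]
  rw [hvieta, Finset.range_eq_Ico, Finset.sum_eq_sum_Ico_succ_bot (by omega), polyFamily]
  simp only [derivative_add, derivative_C_mul, derivative_X_pow, derivative_sum, derivative_C,
    add_zero]
  have h1 : ∀ j ∈ Finset.Icc 2 (d - 1),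
      C ((-1) ^ (d - j) / (j : ℂ) * sigma p.1 (d - j)) * (C (j : ℂ) * X ^ (j - 1)) =
        C ((-1) ^ (d - j) * sigma p.1 (d - j)) * X ^ (j - 1) := by
    intro j hj
    have hj0 : (j : ℂ) ≠ 0 := by
      have := (Finset.mem_Icc.1 hj).1
      exact_mod_cast (by omega : j ≠ 0)
    rw [← mul_assoc, ← C_mul]
    congr 2
    field_simp
  rw [Finset.sum_congr rfl h1, hsum, ← mul_assoc, ← C_mul, one_div_mul_cancel hd0, C_1, one_mul,
    mul_add]
  congr 1
  · have hs0 : sigma p.1 0 = 1 := by simp [sigma_eq_sum]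
    rw [hs0, pow_zero, one_mul, C_1, one_mul, ← pow_succ']
    congr 1
    omega
  · rw [Finset.mul_sum]
    refine Finset.sum_congr (by ext k; simp only [Finset.mem_Icc, Finset.mem_Ico]; omega)
      fun k hk => ?_
    have hk' := Finset.mem_Ico.1 hk
    have : d - k - 1 = d - 2 - k + 1 := by omega
    rw [this, pow_succ, C_mul, C_pow, C_neg, C_1]
    ring

lemma derivative_polyFamily_eval_eq_zero_iff (hd : 2 ≤ d) (p : Param d) (z : ℂ) :
    (polyFamily d p).derivative.eval z = 0 ↔ ∃ i, critPt p i = z := by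
  rw [derivative_polyFamily hd, eval_mul, eval_X, eval_prod, mul_eq_zero, Finset.prod_eq_zero_iff,
    Fin.exists_fin_succ]
  simp [critPt, sub_eq_zero, eq_comm (a := z)]

lemma natDegree_polyFamily_pos (hd : 2 ≤ d) (p : Param d) : 0 < (polyFamily d p).natDegree := by
  by_contra! h0
  have h1 : (polyFamily d p).derivative = 0 := by
    rw [eq_C_of_natDegree_le_zero h0, derivative_C]
  rw [derivative_polyFamily hd] at h1
  exact (mul_ne_zero X_ne_zero (Finset.prod_ne_zero_iff.2 fun i _ => X_sub_C_ne_zero _)) h1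

/-- The hypersurfaces `α_i = 0` have only the origin in common. -/
lemma eq_zero_of_alpha_eq_zero (hd : 2 ≤ d) {p : Param d} (hp : ∀ i, alpha d i p = 0) : p = 0 := by
  have hder0 : (polyFamily d p).derivative ≠ 0 := by
    rw [derivative_polyFamily hd]
    exact mul_ne_zero X_ne_zero (Finset.prod_ne_zero_iff.2 fun i _ => X_sub_C_ne_zero _)
  have hcard := card_roots_derivative_le_one (natDegree_polyFamily_pos hd p) fun t ht => by
    obtain ⟨i, rfl⟩ := (derivative_polyFamily_eval_eq_zero_iff hd p t).1 ht
    exact hp i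
  have hmem : ∀ i, critPt p i ∈ (polyFamily d p).derivative.roots.toFinset := fun i => by
    rw [Multiset.mem_toFinset, mem_roots hder0]
    exact (derivative_polyFamily_eval_eq_zero_iff hd p _).2 ⟨i, rfl⟩
  -- The single critical point must be the marked `c_0 = 0`; it remains to read off `P(0) = a ^ d`.
  have hcrit : ∀ i, critPt p i = 0 := fun i =>
    Finset.card_le_one.1 hcard _ (hmem i) _ (hmem 0)
  have h1 : p.1 = 0 := funext fun i => by simpa [critPt] using hcrit i.succ
  have h2 : p.2 = 0 := by
    have := hp 0
    rw [alpha, hcrit, eval_polyFamily, zero_pow (by omega), mul_zero, zero_add,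
      Finset.sum_eq_zero, zero_add] at this
    · exact eq_zero_of_pow_eq_zero this
    · intro j hj
      have := (Finset.mem_Icc.1 hj).1
      rw [zero_pow (by omega), mul_zero]
  exact Prod.ext h1 h2

/-! ### Growth estimates uniform in the parameter -/

/-- By homogeneity `P_p(z) = z ^ d * P_{p/z}(1)`, and for `p/z` near 0 the last factor is close to
`1 / d`, hence of modulus above half of it. -/
lemma exists_growth (hd : 2 ≤ d) : ∃ Λ : ℝ, 0 < Λ ∧ ∀ (p : Param d) (z : ℂ), Λ * ‖p‖ ≤ ‖z‖ →
    ‖z‖ ^ d / (2 * d) ≤ ‖(polyFamily d p).eval z‖ := by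
  have hd0 : (0 : ℝ) < d := by exact_mod_cast (by omega : 0 < d)
  have hcont : Continuous fun p : Param d => ‖(polyFamily d p).eval 1‖ :=
    (continuous_eval_polyFamily.comp (continuous_id.prodMk continuous_const)).norm
  have h0 : ‖(polyFamily d (0 : Param d)).eval 1‖ = 1 / d := by
    rw [eval_polyFamily, Prod.snd_zero, zero_pow (by omega), Finset.sum_eq_zero]
    · simp
    · intro j hj
      have hj' := Finset.mem_Icc.1 hj
      have := sigma_smul (0 : ℂ) (0 : Fin (d - 2) → ℂ) (d - j)
      rw [zero_smul, zero_pow (by omega), zero_mul] at this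
      rw [Prod.fst_zero, this, mul_zero, zero_mul]
  have hev : ∀ᶠ p : Param d in 𝓝 0, 1 / (2 * d) < ‖(polyFamily d p).eval 1‖ := by
    refine hcont.continuousAt.eventually_const_lt ?_
    simp only [h0]
    exact one_div_lt_one_div_of_lt hd0 (by linarith)
  obtain ⟨δ, hδ, hball⟩ := Metric.eventually_nhds_iff.1 hev
  refine ⟨2 / δ, by positivity, fun p z hz => ?_⟩
  rcases eq_or_ne z 0 with rfl | hz0
  · rw [norm_zero, zero_pow (by omega), zero_div]
    exact norm_nonneg _
  have hzpos : 0 < ‖z‖ := norm_pos_iff.2 hz0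
  have hsmall : ‖z⁻¹ • p‖ < δ := by
    rw [norm_smul, norm_inv, inv_mul_lt_iff₀ hzpos]
    rw [div_mul_eq_mul_div, div_le_iff₀ hδ] at hz
    nlinarith [norm_nonneg p]
  have h1 := hball (y := z⁻¹ • p) (by rwa [dist_zero_right])
  have h2 := eval_polyFamily_smul z (z⁻¹ • p) 1
  rw [smul_inv_smul₀ hz0, mul_one] at h2
  rw [h2, norm_mul, norm_pow, div_eq_mul_one_div]
  exact mul_le_mul_of_nonneg_left h1.le (by positivity)

lemma exists_isEscapeRadius (hd : 2 ≤ d) : ∃ Λ : ℝ, 0 < Λ ∧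
    ∀ p : Param d, IsEscapeRadius (polyFamily d p) (Λ * ‖p‖ + 4 * d) := by
  obtain ⟨Λ, hΛ, hgrow⟩ := exists_growth hd
  have hd2 : (2 : ℝ) ≤ d := by exact_mod_cast hd
  refine ⟨Λ, hΛ, fun p => ⟨by positivity, fun z hz => ?_⟩⟩
  have hp : 0 ≤ Λ * ‖p‖ := by positivity
  refine le_trans ?_ (hgrow p z (by linarith))
  have hz1 : 1 ≤ ‖z‖ := by linarith
  have hpow : ‖z‖ ^ 2 ≤ ‖z‖ ^ d := pow_le_pow_right₀ hz1 hd
  -- The summand `4 * d` is chosen so that `‖z‖ ^ 2 / (2 * d) ≥ 2 * ‖z‖`.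
  rw [le_div_iff₀ (by linarith)]
  nlinarith

lemma mem_boundedCritLocus_iff {i : Fin (d - 2 + 1)} {p : Param d} :
    p ∈ boundedCritLocus d i ↔ critPt p i ∈ filledJulia (polyFamily d p) :=
  Iff.rfl

lemma norm_alpha_lt {p : Param d} {R : ℝ} (hR : IsEscapeRadius (polyFamily d p) R)
    {i : Fin (d - 2 + 1)} (hp : p ∈ boundedCritLocus d i) : ‖alpha d i p‖ < R := by
  have := hR.mem_iff_lt.1 (mem_boundedCritLocus_iff.1 hp) 1
  rwa [eval_iterPoly_succ, eval_iterPoly_zero] at this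

/-! ### The cluster set at infinity -/

/-- The preimage of this set among nonzero vectors is the trace of the cone `U`, and the topology is
the quotient one. -/
lemma isOpen_projectivization_of_smul {V : Type*} [AddCommGroup V] [Module ℂ V]
    [TopologicalSpace V] {U : Set V} (hU : IsOpen U)
    (hsmul : ∀ (t : ℂ) (v : V), t ≠ 0 → v ∈ U → t • v ∈ U) :
    IsOpen {x : ℙ ℂ V | ∀ (v : V) (hv : v ≠ 0), Projectivization.mk ℂ v hv = x → v ∈ U} := by
  have key : {v : {v : V // v ≠ 0} | ∀ (w : V) (hw : w ≠ 0),
      Projectivization.mk ℂ w hw = Projectivization.mk ℂ v.1 v.2 → w ∈ U} = Subtype.val ⁻¹' U := by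
    ext v
    refine ⟨fun hv => hv v.1 v.2 rfl, fun hv w hw hwv => ?_⟩
    obtain ⟨t, rfl⟩ := (Projectivization.mk_eq_mk_iff ℂ _ _ _ _).1 hwv
    exact hsmul t _ t.ne_zero hv
  change IsOpen {v : {v : V // v ≠ 0} | ∀ (w : V) (hw : w ≠ 0),
      Projectivization.mk ℂ w hw = Projectivization.mk ℂ v.1 v.2 → w ∈ U}
  rw [key]
  exact hU.preimage continuous_subtype_val

theorem clusterSetAtInfinity_boundedCritLocus_subset (hd : 2 ≤ d) (i : Fin (d - 2 + 1)) :
    clusterSetAtInfinity d (boundedCritLocus d i) ⊆ Gam d i := by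
  obtain ⟨Λ, hΛ, hesc⟩ := exists_isEscapeRadius hd
  rintro x ⟨⟨p, hp, rfl⟩, hx⟩
  refine ⟨p, hp, rfl, ?_⟩
  by_contra hα
  -- This homogenizes `Λ * ‖p‖ + 4 * d < ‖α_i p‖` to degree `d`. At `t = 0` it says `α_i ≠ 0`; at `t
  -- = 1` it excludes bounded orbits of `c_i`.
  set U : Set (Param d × ℂ) := {v | Λ * ‖v.1‖ * ‖v.2‖ ^ (d - 1) + 4 * d * ‖v.2‖ ^ d <
    ‖alpha d i v.1‖} with hU
  have hUo : IsOpen U := isOpen_lt (by fun_prop) ((continuous_alpha i).comp continuous_fst).norm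
  have hpow : ∀ a : ℝ, a ^ d = a * a ^ (d - 1) := fun a => by
    rw [← pow_succ']; congr 1; omega
  have hsmul : ∀ (t : ℂ) (v : Param d × ℂ), t ≠ 0 → v ∈ U → t • v ∈ U := by
    intro t v ht hv
    have htd : 0 < ‖t‖ ^ d := pow_pos (norm_pos_iff.2 ht) d
    rw [hU, mem_ofPred_eq] at hv ⊢
    rw [Prod.smul_fst, Prod.smul_snd, alpha_smul, norm_mul, norm_pow, norm_smul, norm_smul,
      mul_pow, mul_pow]
    refine lt_of_eq_of_lt ?_ (mul_lt_mul_of_pos_left hv htd)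
    rw [hpow ‖t‖]
    ring
  have hWo := isOpen_projectivization_of_smul hUo hsmul
  rw [← mem_closure_iff_clusterPt, mem_closure_iff] at hx
  obtain ⟨_, hyW, q, hq, rfl⟩ := hx _ hWo (by
    intro v hv hvx
    obtain ⟨t, ht⟩ := (Projectivization.mk_eq_mk_iff ℂ _ _ _ _).1 hvx
    rw [← ht]
    refine hsmul t _ t.ne_zero ?_
    rw [hU, mem_ofPred_eq, norm_zero, zero_pow (by omega), zero_pow (by omega), mul_zero, mul_zero,
      add_zero]
    exact norm_pos_iff.2 hα)
  have hqU : ((q, 1) : Param d × ℂ) ∈ U := hyW _ _ rfl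
  rw [hU, mem_ofPred_eq, norm_one, one_pow, one_pow, mul_one, mul_one] at hqU
  exact lt_asymm hqU (norm_alpha_lt (hesc q) hq)

/-! ### Compactness of the connectedness locus -/

lemma connectednessLocus_eq (hd : 2 ≤ d) :
    connectednessLocus d = ⋂ i, boundedCritLocus d i := by
  obtain ⟨Λ, -, hesc⟩ := exists_isEscapeRadius hd
  ext p
  rw [mem_iInter]
  change IsConnected (juliaSet (polyFamily d p)) ↔ _
  rw [(hesc p).isConnected_juliaSet_iff_critPt
    ⟨critPt p 0, (derivative_polyFamily_eval_eq_zero_iff hd p _).2 ⟨0, rfl⟩⟩]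
  simp only [derivative_polyFamily_eval_eq_zero_iff hd, mem_boundedCritLocus_iff,
    forall_exists_index, forall_apply_eq_imp_iff]

/-- The escape radius depends continuously on the parameter, so boundedness is a family of closed
conditions. -/
lemma isClosed_boundedCritLocus (hd : 2 ≤ d) (i : Fin (d - 2 + 1)) :
    IsClosed (boundedCritLocus d i) := by
  obtain ⟨Λ, -, hesc⟩ := exists_isEscapeRadius hd
  have hcont : ∀ n, Continuous fun p : Param d =>
      (iterPoly (polyFamily d p) n).eval (critPt p i) := by
    intro n
    induction n with
    | zero => simpa only [eval_iterPoly_zero] using continuous_critPt i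
    | succ n ih =>
      simp only [eval_iterPoly_succ]
      exact continuous_eval_polyFamily.comp (continuous_id.prodMk ih)
  have : boundedCritLocus d i = ⋂ n, {p : Param d |
      ‖(iterPoly (polyFamily d p) n).eval (critPt p i)‖ ≤ Λ * ‖p‖ + 4 * d} := by
    ext p
    rw [mem_boundedCritLocus_iff, (hesc p).mem_iff_le, mem_iInter]
    rfl
  rw [this]
  exact isClosed_iInter fun n => isClosed_le (hcont n).norm (by fun_prop)

/-- The sum has a positive minimum on the unit sphere, by compactness and the absence of nontrivial
common zeros; homogeneity does the rest. -/
lemma exists_le_sum_norm_alpha (hd : 2 ≤ d) : ∃ ε : ℝ, 0 < ε ∧ ∀ p : Param d,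
    ε * ‖p‖ ^ d ≤ ∑ i, ‖alpha d i p‖ := by
  have hcont : Continuous fun p : Param d => ∑ i, ‖alpha d i p‖ :=
    continuous_finsetSum _ fun i _ => (continuous_alpha i).norm
  obtain ⟨p₀, hp₀, hmin⟩ := (isCompact_sphere (0 : Param d) 1).exists_isMinOn
    (NormedSpace.sphere_nonempty.2 zero_le_one) hcont.continuousOn
  have hpos : 0 < ∑ i, ‖alpha d i p₀‖ := by
    refine lt_of_le_of_ne (Finset.sum_nonneg fun i _ => norm_nonneg _) fun h0 => ?_
    have h1 := (Finset.sum_eq_zero_iff_of_nonneg fun i _ => norm_nonneg _).1 h0.symm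
    have h2 := eq_zero_of_alpha_eq_zero hd fun i => norm_eq_zero.1 (h1 i (Finset.mem_univ i))
    rw [h2] at hp₀
    simp at hp₀
  refine ⟨_, hpos, fun p => ?_⟩
  rcases eq_or_ne p 0 with rfl | hp
  · rw [norm_zero, zero_pow (by omega), mul_zero]
    exact Finset.sum_nonneg fun i _ => norm_nonneg _
  have hp0 : (‖p‖ : ℂ) ≠ 0 := by exact_mod_cast norm_ne_zero_iff.2 hp
  have h1 : ∑ i, ‖alpha d i p₀‖ ≤ ∑ i, ‖alpha d i ((‖p‖ : ℂ)⁻¹ • p)‖ := by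
    refine hmin ?_
    rw [mem_sphere_zero_iff_norm, norm_smul, norm_inv, Complex.norm_real, norm_norm,
      inv_mul_cancel₀ (norm_ne_zero_iff.2 hp)]
  have h2 : ∀ i, ‖alpha d i p‖ = ‖alpha d i ((‖p‖ : ℂ)⁻¹ • p)‖ * ‖p‖ ^ d := fun i => by
    conv_lhs => rw [← smul_inv_smul₀ hp0 p]
    rw [alpha_smul, norm_mul, norm_pow, Complex.norm_real, norm_norm, mul_comm]
  rw [Finset.sum_congr rfl fun i _ => h2 i, ← Finset.sum_mul]
  exact mul_le_mul_of_nonneg_right h1 (by positivity)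

theorem isCompact_connectednessLocus (hd : 2 ≤ d) : IsCompact (connectednessLocus d) := by
  refine Metric.isCompact_of_isClosed_isBounded ?_ ?_
  · rw [connectednessLocus_eq hd]
    exact isClosed_iInter (isClosed_boundedCritLocus hd)
  obtain ⟨Λ, hΛ, hesc⟩ := exists_isEscapeRadius hd
  obtain ⟨ε, hε, hle⟩ := exists_le_sum_norm_alpha hd
  -- For `‖p‖ ≥ 1` the sum of the bounds on all `‖α_i‖` is at most `A * ‖p‖`; with `ε * ‖p‖ ^ 2 ≤ ε
  -- * ‖p‖ ^ d` this forces `‖p‖ ≤ A / ε`.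
  set A : ℝ := (d - 2 + 1 : ℕ) * (Λ + 4 * d) with hA
  refine (Metric.isBounded_closedBall (x := (0 : Param d)) (r := max 1 (A / ε))).subset
    fun p hp => ?_
  rw [mem_closedBall_zero_iff, le_max_iff]
  by_contra! hlt
  rw [connectednessLocus_eq hd, mem_iInter] at hp
  have h1 : ∑ i, ‖alpha d i p‖ ≤ A * ‖p‖ := by
    calc ∑ i, ‖alpha d i p‖ ≤ ∑ _i : Fin (d - 2 + 1), (Λ * ‖p‖ + 4 * d) :=
          Finset.sum_le_sum fun i _ => (norm_alpha_lt (hesc p) (hp i)).le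
      _ = (d - 2 + 1 : ℕ) * (Λ * ‖p‖ + 4 * d) := by
          rw [Finset.sum_const, Finset.card_univ, Fintype.card_fin, nsmul_eq_mul]
      _ ≤ A * ‖p‖ := by
          rw [hA, mul_assoc]
          refine mul_le_mul_of_nonneg_left ?_ (Nat.cast_nonneg _)
          nlinarith [hlt.1, (Nat.cast_nonneg d : (0 : ℝ) ≤ d)]
  have h2 : ‖p‖ ^ 2 ≤ ‖p‖ ^ d := pow_le_pow_right₀ hlt.1.le hd
  have h3 := (hle p).trans h1
  have h4 : A < ‖p‖ * ε := (div_lt_iff₀ hε).1 hlt.2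
  nlinarith [mul_le_mul_of_nonneg_left h2 hε.le, hlt.1]

end

theorem mainTheorem4 (d : ℕ) (hd : 2 ≤ d) :
    (∀ i : Fin (d - 2 + 1),
      clusterSetAtInfinity d (boundedCritLocus d i) ⊆ Gam d i) ∧
    IsCompact (connectednessLocus d) :=
  ⟨clusterSetAtInfinity_boundedCritLocus_subset hd, isCompact_connectednessLocus hd⟩
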